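/- Let $M$ be a smooth oriented manifold of dimension $n$ and let $\pi:P\to M$ be a smooth principal $\mathbb{R}^\times$-bundle ($\mathbb{R}^\times=\mathbb{R}\setminus\{0\}$), so $\dim P=n+1$. Let $\Delta_P$ be the Euler vector field, i.e. the fundamental vector field $\Delta_P(p)=\frac{d}{ds}\big|_{s=0}e^{s}\cdot p$ of the action. Let $g$ be a smooth degenerate metric on $P$ of signature $(1,\dots,1,0)$ whose kernel at each point is the vertical space $\ker d\pi$, and suppose that $\Delta_P$ is a Killing vector field, $\mathcal{L}_{\Delta_P}g=0$. Let $\theta\in\Omega^1(P)$ be the connection one-form of a principal connection, i.e. $\theta$ is $\mathbb{R}^\times$-invariant and $\theta(\Delta_P)=1$. Let $G:=g-\theta\otimes\theta$ be the associated Lorentzian metric, $\langle\cdot,\cdot\rangle_G$ the induced pointwise inner product of forms, and $\mathsf{Vol}_P:=(-1)^n\,\theta\wedge\mathsf{Vol}_M$. Here $\mathsf{Vol}_M$ denotes the pullback to $P$ of the Riemannian volume form of the oriented base; precisely, $\mathsf{Vol}_M$ at $p\in P$ is the pullback along $d\pi_p$ of the positively oriented volume element of $T_{\pi(p)}M\cong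 T_pP/\ker d\pi_p$ with the inner product induced by $g_p$. The Hodge star $\star:\Omega^k(P)\to\Omega^{n+1-k}(P)$, $0\le k\le n+1$, is defined by requiring $\eta\wedge\star\xi=\langle\eta,\xi\rangle_G\,\mathsf{Vol}_P$ for all $k$-forms $\eta$. The codifferential is $\delta\xi:=(-1)^{1+k(n+1-k)}\star d\star\xi$ for $\xi\in\Omega^k(P)$ (with $\delta=0$ on functions), and the Hodge–de Rham Laplacian is $\Delta_{HdR}:=d\circ\delta+\delta\circ d$. A form $\xi\in\Omega^k(P)$ is homogeneous of weight $\lambda\in\mathbb{R}$ if $\mathcal{L}_{\Delta_P}\xi=\lambda\xi$. Then $\star\xi$ exists, is unique and is smooth for every smooth $\xi$, so that these operators are well-defined maps $\delta:\Omega^k(P)\to\Omega^{k-1}(P)$ and $\Delta_{HdR}:\Omega^k(P)\to\Omega^k(P)$. They commute with the Lie derivative along the Euler vector field: for every $k$ and every $\xi\in\Omega^k(P)$, $$\mathcal{L}_{\Delta_P}(\delta\xi)=\delta(\mathcal{L}_{\Delta_P}\xi),\qquad \mathcal{L}_{\Delta_P}(\Delta_{HdR}\xi)=\Delta_{HdR}(\mathcal{L}_{\Delta_P}\xi).$$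 In particular, if $\xi\in\Omega^k(P)$ is homogeneous of weight $\lambda$, then so are $\delta\xi\in\Omega^{k-1}(P)$ and $\Delta_{HdR}\xi\in\Omega^k(P)$. -/

import Mathlib

open scoped Manifold ContDiff Topology
open Bundle

noncomputable section

/-! ### Linear algebra of alternating forms on one vector space -/

section Pointwise

variable {V : Type*} [AddCommGroup V] [Module ℝ V] [TopologicalSpace V]

/-- The (non-alternating) product `v ↦ α (v₀, …, v_{k-1}) * β (v_k, …, v_{k+m-1})` of two
alternating forms. -/
def formTensor {k m N : ℕ} (h : k + m = N) (α : V [⋀^Fin k]→L[ℝ] ℝ) (β : V [⋀^Fin m]→L[ℝ] ℝ) :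
    ContinuousMultilinearMap ℝ (fun _ : Fin N => V) ℝ where
  toMultilinearMap :=
    ((LinearMap.mul' ℝ ℝ).compMultilinearMap
      (MultilinearMap.domCoprod α.toContinuousMultilinearMap.toMultilinearMap
        β.toContinuousMultilinearMap.toMultilinearMap)).domDomCongr
      (finSumFinEquiv.trans (finCongr h))
  cont := by
    have hα : Continuous fun v : Fin N → V =>
        α (fun i => v ((finSumFinEquiv.trans (finCongr h)) (Sum.inl i))) :=
      α.cont.comp (continuous_pi fun i => continuous_apply _)
    have hβ : Continuous fun v : Fin N → V =>
        β (fun i => v ((finSumFinEquiv.trans (finCongr h)) (Sum.inr i))) :=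
      β.cont.comp (continuous_pi fun i => continuous_apply _)
    exact hα.mul hβ

theorem formTensor_apply {k m N : ℕ} (h : k + m = N) (α : V [⋀^Fin k]→L[ℝ] ℝ)
    (β : V [⋀^Fin m]→L[ℝ] ℝ) (v : Fin N → V) :
    formTensor h α β v = α (fun i => v (Fin.cast h (Fin.castAdd m i))) *
      β (fun i => v (Fin.cast h (Fin.natAdd k i))) :=
  rfl

/-- The exterior product of alternating forms, in the usual ("determinant") normalisation
`(α ∧ β)(v) = 1 / (k! m!) * ∑ σ, sign σ * α (v_{σ 0}, …) * β (v_{σ k}, …)`, so that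
`(e¹ ∧ ⋯ ∧ eʲ)(e₁, …, e_j) = 1`. -/
def wedge {k m N : ℕ} (h : k + m = N) (α : V [⋀^Fin k]→L[ℝ] ℝ) (β : V [⋀^Fin m]→L[ℝ] ℝ) :
    V [⋀^Fin N]→L[ℝ] ℝ :=
  ((k.factorial : ℝ) * (m.factorial : ℝ))⁻¹ •
    ContinuousMultilinearMap.alternatization (formTensor h α β)

/-- The inner product on `k`-forms induced by a nondegenerate symmetric bilinear form `B`, written
in a basis `b`: with `B^{ac}` the inverse of the Gram matrix `B (b_a, b_c)`, it is
`⟨η, ξ⟩ = 1 / k! * ∑ B^{i₁j₁} ⋯ B^{i_kj_k} η_{i₁…i_k} ξ_{j₁…j_k}`. -/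
def formInner {ι : Type*} [Fintype ι] [DecidableEq ι] (b : Module.Basis ι ℝ V) (B : V → V → ℝ)
    {k : ℕ} (η ξ : V [⋀^Fin k]→L[ℝ] ℝ) : ℝ :=
  (k.factorial : ℝ)⁻¹ * ∑ i : Fin k → ι, ∑ j : Fin k → ι,
    (∏ s, (Matrix.of fun a c => B (b a) (b c))⁻¹ (i s) (j s)) *
      η (fun s => b (i s)) * ξ (fun s => b (j s))

end Pointwise

/-! ### Differential forms on a manifold modelled on `ℝ^N` -/

section Forms

/-- Fields of alternating `k`-forms on a manifold `X` of dimension `N` (no smoothness yet). -/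
abbrev DForm (N : ℕ) (X : Type*) [TopologicalSpace X] [ChartedSpace (EuclideanSpace ℝ (Fin N)) X]
    (k : ℕ) : Type _ :=
  ∀ x : X, TangentSpace (𝓡 N) x [⋀^Fin k]→L[ℝ] ℝ

/-- The standard basis of the tangent space at `x` in the preferred chart at `x`. -/
def tangentBasis (N : ℕ) {X : Type*} [TopologicalSpace X]
    [ChartedSpace (EuclideanSpace ℝ (Fin N)) X] (x : X) :
    Module.Basis (Fin N) ℝ (TangentSpace (𝓡 N) x) :=
  (EuclideanSpace.basisFun (Fin N) ℝ).toBasis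

variable {N : ℕ} {X : Type*} [TopologicalSpace X] [ChartedSpace (EuclideanSpace ℝ (Fin N)) X]
  {N' : ℕ} {Y : Type*} [TopologicalSpace Y] [ChartedSpace (EuclideanSpace ℝ (Fin N')) Y]

/-- `ξ ∈ Ω^k(X)`: the field `ξ` is a smooth section of the bundle of alternating `k`-forms. -/
def IsSmoothForm [IsManifold (𝓡 N) ∞ X] {k : ℕ} (ξ : DForm N X k) : Prop :=
  ContMDiff (𝓡 N) ((𝓡 N).prod 𝓘(ℝ, EuclideanSpace ℝ (Fin N) [⋀^Fin k]→L[ℝ] ℝ)) ∞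
    (fun x => TotalSpace.mk' (EuclideanSpace ℝ (Fin N) [⋀^Fin k]→L[ℝ] ℝ)
      (E := fun x : X => TangentSpace (𝓡 N) x [⋀^Fin k]→L[ℝ] (Bundle.Trivial X ℝ x)) x (ξ x))

/-- The pullback `f^* ξ`. -/
def formPullback (f : X → Y) {k : ℕ} (ξ : DForm N' Y k) : DForm N X k :=
  fun x => (ξ (f x)).compContinuousLinearMap (mfderiv (𝓡 N) (𝓡 N') f x)

/-- The representative of `ξ` in the preferred chart at `x₀`, a form on (the chart's target in)
`ℝ^N`. -/
def formInChart {k : ℕ} (ξ : DForm N X k) (x₀ : X) (y : EuclideanSpace ℝ (Fin N)) :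
    EuclideanSpace ℝ (Fin N) [⋀^Fin k]→L[ℝ] ℝ :=
  (ξ ((extChartAt (𝓡 N) x₀).symm y)).compContinuousLinearMap
    (mfderiv 𝓘(ℝ, EuclideanSpace ℝ (Fin N)) (𝓡 N) (extChartAt (𝓡 N) x₀).symm y)

/-- The de Rham differential, computed at each point in the preferred chart at that point. -/
def formD {k : ℕ} (ξ : DForm N X k) : DForm N X (k + 1) := fun x =>
  (extDeriv (formInChart ξ x) (extChartAt (𝓡 N) x x)).compContinuousLinearMap
    (mfderiv (𝓡 N) 𝓘(ℝ, EuclideanSpace ℝ (Fin N)) (extChartAt (𝓡 N) x) x)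

end Forms

/-! ### Carrollian `ℝˣ`-bundles with a connection -/

section Carroll

variable {n : ℕ}
  {M : Type*} [TopologicalSpace M] [ChartedSpace (EuclideanSpace ℝ (Fin n)) M]
  {P : Type*} [TopologicalSpace P] [ChartedSpace (EuclideanSpace ℝ (Fin (n + 1))) P]
  [MulAction ℝˣ P]

/-- `pr : P → M` is a smooth principal `ℝˣ`-bundle (`dim M = n`, `dim P = n + 1`): `ℝˣ` acts
smoothly on `P`, `pr` is smooth and invariant, and over a neighbourhood `U` of each point of `M`
there is an equivariant diffeomorphism `pr⁻¹(U) ≅ U × ℝˣ` over `U`. -/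
structure IsPrincipalRxBundle (n : ℕ)
    {M : Type*} [TopologicalSpace M] [ChartedSpace (EuclideanSpace ℝ (Fin n)) M]
    {P : Type*} [TopologicalSpace P] [ChartedSpace (EuclideanSpace ℝ (Fin (n + 1))) P]
    [MulAction ℝˣ P] (pr : P → M) : Prop where
  smooth_smul : ContMDiff (𝓘(ℝ, ℝ).prod (𝓡 (n + 1))) (𝓡 (n + 1)) ∞
    (fun q : ℝˣ × P => q.1 • q.2)
  smooth_proj : ContMDiff (𝓡 (n + 1)) (𝓡 n) ∞ pr
  proj_smul : ∀ (a : ℝˣ) (p : P), pr (a • p) = pr p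
  locally_trivial : ∀ x : M, ∃ (U : Set M) (e : OpenPartialHomeomorph P (M × ℝˣ)),
    IsOpen U ∧ x ∈ U ∧ e.source = pr ⁻¹' U ∧ e.target = U ×ˢ Set.univ ∧
    ContMDiffOn (𝓡 (n + 1)) ((𝓡 n).prod 𝓘(ℝ, ℝ)) ∞ e e.source ∧
    ContMDiffOn ((𝓡 n).prod 𝓘(ℝ, ℝ)) (𝓡 (n + 1)) ∞ e.symm e.target ∧
    (∀ p ∈ e.source, (e p).1 = pr p) ∧
    (∀ (a : ℝˣ), ∀ p ∈ e.source, (e (a • p)).2 = a * (e p).2)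

/-- The flow `p ↦ exp(s) • p` of the Euler vector field. -/
def eulerFlow (s : ℝ) (p : P) : P :=
  Units.mk0 (Real.exp s) (Real.exp_ne_zero s) • p

/-- The Euler vector field `Δ_P`, the fundamental vector field of the action: its value at `p` is
the velocity of `s ↦ exp(s) • p` at `s = 0`. -/
def eulerField (n : ℕ) {P : Type*} [TopologicalSpace P]
    [ChartedSpace (EuclideanSpace ℝ (Fin (n + 1))) P] [MulAction ℝˣ P] (p : P) :
    TangentSpace (𝓡 (n + 1)) p :=
  (mfderiv 𝓘(ℝ, ℝ) (𝓡 (n + 1)) (fun s : ℝ => eulerFlow s p) 0 :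
    ℝ →L[ℝ] EuclideanSpace ℝ (Fin (n + 1))) 1

/-- The Lie derivative along the Euler vector field: the derivative at `s = 0` of the pullback
along its flow. -/
def lieEuler {k : ℕ} (ξ : DForm (n + 1) P k) : DForm (n + 1) P k := fun p =>
  (deriv (fun s : ℝ => (formPullback (eulerFlow s) ξ p :
    EuclideanSpace ℝ (Fin (n + 1)) [⋀^Fin k]→L[ℝ] ℝ)) 0 :
    EuclideanSpace ℝ (Fin (n + 1)) [⋀^Fin k]→L[ℝ] ℝ)

/-- `ξ` is homogeneous of weight `w`. -/
def IsHomogeneousOfWeight {k : ℕ} (w : ℝ) (ξ : DForm (n + 1) P k) : Prop :=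
  lieEuler ξ = w • ξ

/-- A degenerate metric `g` on `P` of signature `(1, …, 1, 0)` whose kernel is the vertical bundle
`ker dpr`. -/
structure CarrollianMetric (n : ℕ)
    {M : Type*} [TopologicalSpace M] [ChartedSpace (EuclideanSpace ℝ (Fin n)) M]
    {P : Type*} [TopologicalSpace P] [ChartedSpace (EuclideanSpace ℝ (Fin (n + 1))) P]
    [IsManifold (𝓡 (n + 1)) ∞ P] (pr : P → M) where
  val : ∀ p : P, TangentSpace (𝓡 (n + 1)) p →L[ℝ] TangentSpace (𝓡 (n + 1)) p →L[ℝ] ℝ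
  smooth : ContMDiff (𝓡 (n + 1))
    ((𝓡 (n + 1)).prod 𝓘(ℝ, EuclideanSpace ℝ (Fin (n + 1)) →L[ℝ]
      EuclideanSpace ℝ (Fin (n + 1)) →L[ℝ] ℝ)) ∞
    (fun p => TotalSpace.mk' (EuclideanSpace ℝ (Fin (n + 1)) →L[ℝ]
      EuclideanSpace ℝ (Fin (n + 1)) →L[ℝ] ℝ)
      (E := fun p : P => TangentSpace (𝓡 (n + 1)) p →L[ℝ] TangentSpace (𝓡 (n + 1)) p →L[ℝ] ℝ)
      p (val p))
  symm : ∀ p u v, val p u v = val p v u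
  nonneg : ∀ p u, 0 ≤ val p u u
  ker : ∀ p u, (∀ v, val p u v = 0) ↔ mfderiv (𝓡 (n + 1)) (𝓡 n) pr p u = 0

/-- The Euler vector field is a Killing vector field of `g`: the Lie derivative of `g` along it
vanishes. -/
def CarrollianMetric.EulerIsKilling [IsManifold (𝓡 (n + 1)) ∞ P] {pr : P → M} (g : CarrollianMetric n pr) : Prop :=
  ∀ (p : P) (u v : TangentSpace (𝓡 (n + 1)) p),
    HasDerivAt (fun s : ℝ => g.val (eulerFlow s p)
      (mfderiv (𝓡 (n + 1)) (𝓡 (n + 1)) (eulerFlow s) p u)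
      (mfderiv (𝓡 (n + 1)) (𝓡 (n + 1)) (eulerFlow s) p v)) 0 0

/-- A principal connection, given by its connection one-form `θ`: a smooth one-form, invariant
under the (abelian) structure group, with `θ (Δ_P) = 1`. -/
structure RxConnection (n : ℕ) (P : Type*) [TopologicalSpace P]
    [ChartedSpace (EuclideanSpace ℝ (Fin (n + 1))) P] [IsManifold (𝓡 (n + 1)) ∞ P]
    [MulAction ℝˣ P] where
  form : DForm (n + 1) P 1
  smooth : IsSmoothForm form
  invariant : ∀ a : ℝˣ, formPullback (fun p : P => a • p) form = form
  euler : ∀ p : P, form p ![eulerField n p] = 1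

/-- An orientation of `M`, represented by a smooth nowhere vanishing form of top degree (only its
class modulo positive functions matters below). -/
structure OrientationForm (n : ℕ) (M : Type*) [TopologicalSpace M]
    [ChartedSpace (EuclideanSpace ℝ (Fin n)) M] [IsManifold (𝓡 n) ∞ M] where
  form : DForm n M n
  smooth : IsSmoothForm form
  ne_zero : ∀ x, form x ≠ 0

variable [IsManifold (𝓡 n) ∞ M] [IsManifold (𝓡 (n + 1)) ∞ P]
  {pr : P → M} (g : CarrollianMetric n pr) (Θ : RxConnection n P) (o : OrientationForm n M)

/-- The Lorentzian metric `G = g - θ ⊗ θ`. -/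
def lorentzMetric (p : P) (u v : TangentSpace (𝓡 (n + 1)) p) : ℝ :=
  g.val p u v - Θ.form p ![u] * Θ.form p ![v]

/-- The pointwise inner product `⟨η, ξ⟩_G` of `k`-forms induced by `G`. -/
def gInner (p : P) {k : ℕ} (η ξ : TangentSpace (𝓡 (n + 1)) p [⋀^Fin k]→L[ℝ] ℝ) : ℝ :=
  formInner (tangentBasis (n + 1) p) (lorentzMetric g Θ p) η ξ

/-- The Riemannian volume form of the oriented base, pulled back to `P`: the positive multiple of
the pulled back orientation form that has length one. On pullbacks of forms on `M` the inner
product of `G` is that of the metric which `g` induces on `T_{pr p} M ≅ T_p P / ker dpr`, so if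
`g = pr^* g_M` this is the pullback of the volume form of `g_M`. -/
def volBase : DForm (n + 1) P n := fun p =>
  (Real.sqrt (gInner g Θ p (formPullback pr o.form p) (formPullback pr o.form p)))⁻¹ •
    formPullback pr o.form p

/-- The volume form `Vol_P = (-1)^n θ ∧ Vol_M`. -/
def volTotal : DForm (n + 1) P (n + 1) := fun p =>
  (-1 : ℝ) ^ n • wedge (Nat.add_comm 1 n) (Θ.form p) (volBase g Θ o p)

/-- `β` is the Hodge dual at `p` of the `k`-form `ξ`: `η ∧ β = ⟨η, ξ⟩_G Vol_P` for all `k`-forms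
`η`. -/
def IsHodgeDualAt (p : P) {k m : ℕ} (h : k + m = n + 1)
    (ξ : TangentSpace (𝓡 (n + 1)) p [⋀^Fin k]→L[ℝ] ℝ)
    (β : TangentSpace (𝓡 (n + 1)) p [⋀^Fin m]→L[ℝ] ℝ) : Prop :=
  ∀ η : TangentSpace (𝓡 (n + 1)) p [⋀^Fin k]→L[ℝ] ℝ,
    wedge h η β = gInner g Θ p η ξ • volTotal g Θ o p

/-- The Hodge star operator `⋆ : Ω^k(P) → Ω^m(P)`, `k + m = n + 1 = dim P`: the form `⋆ξ` with
`η ∧ ⋆ξ = ⟨η, ξ⟩_G Vol_P` for all `η`. -/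
def hodgeStar {k m : ℕ} (h : k + m = n + 1) (ξ : DForm (n + 1) P k) : DForm (n + 1) P m :=
  fun p => Classical.epsilon (IsHodgeDualAt g Θ o p h (ξ p))

/-- The codifferential `δ : Ω^{k+1}(P) → Ω^k(P)`, `δ ξ = (-1)^{1 + r (n + 1 - r)} ⋆ d ⋆ ξ` where
`r = k + 1` is the degree of `ξ`. Forms of degree `r > n + 1` vanish, and so does `δ` on them. -/
def codiff {k : ℕ} (ξ : DForm (n + 1) P (k + 1)) : DForm (n + 1) P k :=
  if h : k + 1 ≤ n + 1 then
    (-1 : ℝ) ^ (1 + (k + 1) * (n + 1 - (k + 1))) •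
      hodgeStar g Θ o (k := n + 1 - (k + 1) + 1) (m := k) (by omega)
        (formD (hodgeStar g Θ o (k := k + 1) (m := n + 1 - (k + 1)) (by omega) ξ))
  else 0

/-- The Hodge–de Rham Laplacian `d ∘ δ + δ ∘ d` on `Ω^k(P)`; on functions `δ = 0`. -/
def hodgeLaplacian : {k : ℕ} → DForm (n + 1) P k → DForm (n + 1) P k
  | 0, ξ => codiff g Θ o (formD ξ)
  | _ + 1, ξ => formD (codiff g Θ o ξ) + codiff g Θ o (formD ξ)

end Carroll

end

/-!
The Euler flow `φ_s(p) = exp(s) • p` consists of diffeomorphisms that preserve all the data from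
which the Hodge star is built. A Killing field has a flow by isometries: by the group property of
the flow, the derivative of `φ_s^* g` vanishes at all times as soon as it does at `s = 0`
(`CarrollianMetric.EulerIsKilling.toCLM_eulerFlow`). The connection form is invariant by definition,
and so is every form pulled back from the base. Hence `G = g - θ ⊗ θ`, the inner product of forms
and `Vol_P` are invariant, and the star commutes with `φ_s^*` (`formPullback_eulerFlow_hodgeStar`).
At each point the star is a fixed linear map, so that it commutes with the derivative at `s = 0` as
well: `lieEuler_hodgeStar`. The same holds for the de Rham differential (`lieEuler_formD`), as
it commutes with pullbacks and, by the symmetry of second derivatives, with differentiation in a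
parameter. The codifferential and the Laplacian are composed of these two operators.

That the star is well defined is linear algebra. If `e` and `f` are dual frames for `G`, that is
`G(f_i, e_j) = δ_ij`, then `⟨η, ξ⟩ = 1 / k! * ∑ η(e_i₁, …) ξ(f_i₁, …)`, and the dual of `ξ` is
`1 / k! * ∑ ξ(f_i₁, …) Vol_P(e_i₁, …, ·)`, because `η ∧ Vol_P(v, ·) = η(v) Vol_P`
(`wedge_contraction_left`); uniqueness is the nondegeneracy of the wedge pairing
(`wedge_left_injective`). Dual frames exist, and `Vol_P` does not vanish, because `g + θ ⊗ θ` is a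
positive definite form with an orthonormal basis beginning with the Euler field, and this basis is
also orthonormal for `G`, with the Euler field timelike (`exists_adapted_basis`). In particular
the pulled back orientation form is horizontal and has positive length.

Smoothness is read off from the same formula in a chart, with the coordinate frame and its dual
frame, whose components are entries of the inverse Gram matrix (`formInChart_hodgeStar`).
-/

/-! ### Exterior products and contractions -/

section ExteriorAlgebra

theorem LinearIndependent.exists_basis_sum {V : Type*} [AddCommGroup V] [Module ℝ V]
    [FiniteDimensional ℝ V] {k m : ℕ} (hV : Module.finrank ℝ V = k + m) {v : Fin k → V}
    (hv : LinearIndependent ℝ v) :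
    ∃ b : Module.Basis (Fin k ⊕ Fin m) ℝ V, ∀ i, b (Sum.inl i) = v i := by
  let b := Module.Basis.sumExtend hv
  have := Module.Finite.finite_basis b
  have : Finite (Module.Basis.sumExtendIndex hv) := Finite.sum_right (Fin k)
  have := Fintype.ofFinite (Module.Basis.sumExtendIndex hv)
  have hc : Fintype.card (Module.Basis.sumExtendIndex hv) = Fintype.card (Fin m) := by
    have := Module.finrank_eq_card_basis b
    rw [hV, Fintype.card_sum, Fintype.card_fin] at this
    rw [Fintype.card_fin]
    omega
  refine ⟨b.reindex (Equiv.sumCongr (Equiv.refl _) (Fintype.equivOfCardEq hc)), fun i => ?_⟩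
  have h1 : b (Sum.inl i) = v i := by
    simp only [b, Module.Basis.sumExtend, Module.Basis.reindex_apply,
      Module.Basis.extend_apply_self]
    rfl
  simpa using h1

variable {V : Type*} [AddCommGroup V] [Module ℝ V] [TopologicalSpace V]

theorem wedge_apply {k m N : ℕ} (h : k + m = N) (α : V [⋀^Fin k]→L[ℝ] ℝ) (β : V [⋀^Fin m]→L[ℝ] ℝ)
    (v : Fin N → V) :
    wedge h α β v = ((k.factorial : ℝ) * (m.factorial : ℝ))⁻¹ *
      ∑ σ : Equiv.Perm (Fin N), ((Equiv.Perm.sign σ : ℤ) : ℝ) *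
        (α (fun i => v (σ (Fin.cast h (Fin.castAdd m i)))) *
          β (fun i => v (σ (Fin.cast h (Fin.natAdd k i))))) := by
  simp only [wedge, ContinuousAlternatingMap.smul_apply, smul_eq_mul,
    ContinuousMultilinearMap.alternatization_apply_apply, formTensor_apply, Function.comp_apply,
    Units.smul_def, zsmul_eq_mul]

/-- If only the block permutations contribute to `α ∧ β` on the vectors `w`, then the value is
`α (w₁) * β (w₂)`: the `k! m!` block permutations all give the same term, which cancels the
normalising factor. -/
theorem wedge_apply_of_shuffle {k m N : ℕ} (h : k + m = N) (α : V [⋀^Fin k]→L[ℝ] ℝ)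
    (β : V [⋀^Fin m]→L[ℝ] ℝ) (w : Fin k ⊕ Fin m → V)
    (hw : ∀ σ : Equiv.Perm (Fin k ⊕ Fin m), σ ∉ (Equiv.Perm.sumCongrHom (Fin k) (Fin m)).range →
      α (fun i => w (σ (Sum.inl i))) * β (fun i => w (σ (Sum.inr i))) = 0) :
    wedge h α β (fun i => w ((finSumFinEquiv.trans (finCongr h)).symm i)) =
      α (fun i => w (Sum.inl i)) * β (fun i => w (Sum.inr i)) := by
  classical
  rw [wedge_apply]
  set e := finSumFinEquiv.trans (finCongr h)
  have he1 : ∀ i, Fin.cast h (Fin.castAdd m i) = e (Sum.inl i) := fun i => by simp [e]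
  have he2 : ∀ i, Fin.cast h (Fin.natAdd k i) = e (Sum.inr i) := fun i => by simp [e]
  simp only [he1, he2]
  rw [← Equiv.sum_comp (Equiv.permCongr e)]
  simp only [Equiv.permCongr_apply, Equiv.symm_apply_apply, Equiv.Perm.sign_permCongr]
  have hsub : ∑ σ : Equiv.Perm (Fin k ⊕ Fin m), ((Equiv.Perm.sign σ : ℤ) : ℝ) *
        (α (fun i => w (σ (Sum.inl i))) * β (fun i => w (σ (Sum.inr i)))) =
      ∑ τ : Equiv.Perm (Fin k) × Equiv.Perm (Fin m),
        α (fun i => w (Sum.inl i)) * β (fun i => w (Sum.inr i)) := by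
    rw [← Finset.sum_subset (Finset.subset_univ
      (Finset.univ.image (Equiv.Perm.sumCongrHom (Fin k) (Fin m))))]
    · rw [Finset.sum_image (Equiv.Perm.sumCongrHom_injective.injOn)]
      refine Finset.sum_congr rfl fun τ _ => ?_
      have h1 : α (fun i => w (Sum.inl (τ.1 i))) =
          ((Equiv.Perm.sign τ.1 : ℤ) : ℝ) * α (fun i => w (Sum.inl i)) := by
        have := α.toAlternatingMap.map_perm (fun i => w (Sum.inl i)) τ.1
        simpa [Units.smul_def, Function.comp_def] using this
      have h2 : β (fun i => w (Sum.inr (τ.2 i))) =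
          ((Equiv.Perm.sign τ.2 : ℤ) : ℝ) * β (fun i => w (Sum.inr i)) := by
        have := β.toAlternatingMap.map_perm (fun i => w (Sum.inr i)) τ.2
        simpa [Units.smul_def, Function.comp_def] using this
      have h3 : ∀ u : ℤˣ, ((u : ℤ) : ℝ) * ((u : ℤ) : ℝ) = 1 := fun u => by
        rw [← Int.cast_mul, ← Units.val_mul, Int.units_mul_self]; simp
      simp only [Equiv.Perm.sumCongrHom_apply, Equiv.Perm.sumCongr_apply, Sum.map_inl, Sum.map_inr,
        h1, h2, Equiv.Perm.sign_sumCongr, Units.val_mul, Int.cast_mul]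
      linear_combination (α (fun i => w (Sum.inl i)) * β (fun i => w (Sum.inr i))) *
        (((Equiv.Perm.sign τ.2 : ℤ) : ℝ) * ((Equiv.Perm.sign τ.2 : ℤ) : ℝ) *
          h3 (Equiv.Perm.sign τ.1) + h3 (Equiv.Perm.sign τ.2))
    · intro σ _ hσ
      rw [hw σ (fun ⟨τ, hτ⟩ => hσ (Finset.mem_image.2 ⟨τ, Finset.mem_univ _, hτ⟩)), mul_zero]
  rw [hsub]
  simp only [Finset.sum_const, Finset.card_univ, Fintype.card_prod, Fintype.card_perm,
    Fintype.card_fin, nsmul_eq_mul, Nat.cast_mul]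
  have := Nat.factorial_ne_zero k
  have := Nat.factorial_ne_zero m
  field_simp

/-- The contraction `w ↦ μ (v, w)` of a form with the vectors `v`, which fill the slots of `μ` that
`e` assigns to `Fin k`. -/
def contraction {k m N : ℕ} (e : Fin k ⊕ Fin m ≃ Fin N) (μ : V [⋀^Fin N]→L[ℝ] ℝ) (v : Fin k → V) :
    V [⋀^Fin m]→L[ℝ] ℝ where
  toMultilinearMap :=
    (μ.toContinuousMultilinearMap.toMultilinearMap.domDomCongr e.symm).currySum v
  cont := by
    have : Continuous fun w : Fin m → V => μ (fun i => Sum.elim v w (e.symm i)) :=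
      μ.cont.comp (continuous_pi fun i => by
        rcases h : e.symm i with j | j
        · simpa using continuous_const
        · simpa using continuous_apply j)
    exact this
  map_eq_zero_of_eq' := fun w i j hij hne =>
    μ.map_eq_zero_of_eq (fun s => Sum.elim v w (e.symm s)) (i := e (Sum.inr i)) (j := e (Sum.inr j))
      (by simpa using hij) (by simpa using hne)

theorem contraction_apply {k m N : ℕ} (e : Fin k ⊕ Fin m ≃ Fin N) (μ : V [⋀^Fin N]→L[ℝ] ℝ)
    (v : Fin k → V) (w : Fin m → V) :
    contraction e μ v w = μ (fun i => Sum.elim v w (e.symm i)) :=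
  rfl

/-- Top degree forms are determined by their value on one basis. -/
theorem ContinuousAlternatingMap.ext_of_basis {N : ℕ} {ι : Type*} (b : Module.Basis ι ℝ V)
    (e : ι ≃ Fin N) {μ ν : V [⋀^Fin N]→L[ℝ] ℝ}
    (h : μ (fun i => b (e.symm i)) = ν (fun i => b (e.symm i))) : μ = ν := by
  have h1 : (μ.toAlternatingMap - ν.toAlternatingMap) (b.reindex e) = 0 := by
    have h2 : (b.reindex e : Fin N → V) = fun i => b (e.symm i) := by ext i; simp
    rw [h2]
    exact sub_eq_zero.2 h
  rw [AlternatingMap.map_basis_eq_zero_iff, sub_eq_zero] at h1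
  exact ContinuousAlternatingMap.toAlternatingMap_injective h1

/-- Both sides are forms of top degree, so it suffices to compare them on a basis that extends `v`;
there every non-block permutation puts a vector of `v` twice into `μ`. -/
theorem wedge_contraction_left {k m N : ℕ} [FiniteDimensional ℝ V] (h : k + m = N)
    (hV : Module.finrank ℝ V = N) (α : V [⋀^Fin k]→L[ℝ] ℝ) (μ : V [⋀^Fin N]→L[ℝ] ℝ)
    (v : Fin k → V) :
    wedge h α (contraction (finSumFinEquiv.trans (finCongr h)) μ v) = α v • μ := by
  set e := finSumFinEquiv.trans (finCongr h) with he
  by_cases hv : LinearIndependent ℝ v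
  · obtain ⟨b, hb⟩ := hv.exists_basis_sum (m := m) (hV.trans h.symm)
    refine ContinuousAlternatingMap.ext_of_basis b e ?_
    rw [wedge_apply_of_shuffle h α _ (fun i => b i)]
    · simp only [hb, contraction_apply, ContinuousAlternatingMap.smul_apply, smul_eq_mul]
      congr 2
      ext i
      rcases e.symm i with j | j <;> simp [hb]
    · intro σ hσ
      have h1 : ¬ Set.MapsTo σ (Set.range Sum.inr) (Set.range Sum.inr) := fun hc =>
        hσ (Equiv.Perm.mem_sumCongrHom_range_of_perm_mapsTo_inl
          ((Equiv.Perm.perm_mapsTo_inl_iff_mapsTo_inr σ).2 hc))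
      simp only [Set.MapsTo, Set.mem_range, not_forall] at h1
      obtain ⟨_, ⟨j, rfl⟩, hj⟩ := h1
      rcases hσj : σ (Sum.inr j) with i | i
      · refine mul_eq_zero_of_right _ (μ.map_eq_zero_of_eq _ (i := e (Sum.inl i))
          (j := e (Sum.inr j)) ?_ (by simp))
        simp [hσj, hb]
      · exact absurd ⟨i, hσj.symm⟩ hj
  · have h1 : α v = 0 := α.toAlternatingMap.map_linearDependent v hv
    have h2 : contraction e μ v = 0 := by
      ext w
      refine μ.toAlternatingMap.map_linearDependent _ fun hc => hv ?_
      have := hc.comp (fun i => e (Sum.inl i)) (fun i j hij => by simpa using hij)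
      simpa [Function.comp_def] using this
    rw [h1, h2]
    ext w
    simp [wedge_apply]

/-- The mirror image of `wedge_contraction_left`. -/
theorem wedge_contraction_right {k m N : ℕ} [FiniteDimensional ℝ V] (h : k + m = N)
    (hV : Module.finrank ℝ V = N) (β : V [⋀^Fin m]→L[ℝ] ℝ) (μ : V [⋀^Fin N]→L[ℝ] ℝ)
    (v : Fin m → V) :
    wedge h (contraction ((Equiv.sumComm _ _).trans (finSumFinEquiv.trans (finCongr h))) μ v) β =
      β v • μ := by
  set e := finSumFinEquiv.trans (finCongr h) with he
  by_cases hv : LinearIndependent ℝ v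
  · obtain ⟨b', hb'⟩ := hv.exists_basis_sum (m := k) (hV.trans (h.symm.trans (Nat.add_comm k m)))
    set b := b'.reindex (Equiv.sumComm _ _) with hbdef
    have hb : ∀ i, b (Sum.inr i) = v i := fun i => by simp [hbdef, hb']
    refine ContinuousAlternatingMap.ext_of_basis b e ?_
    rw [wedge_apply_of_shuffle h _ β (fun i => b i)]
    · simp only [hb, contraction_apply, ContinuousAlternatingMap.smul_apply, smul_eq_mul]
      rw [mul_comm]
      congr 2
      ext i
      simp only [Equiv.symm_trans_apply]
      rcases e.symm i with j | j <;> simp [hb]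
    · intro σ hσ
      have h1 : ¬ Set.MapsTo σ (Set.range Sum.inl) (Set.range Sum.inl) := fun hc =>
        hσ (Equiv.Perm.mem_sumCongrHom_range_of_perm_mapsTo_inl hc)
      simp only [Set.MapsTo, Set.mem_range, not_forall] at h1
      obtain ⟨_, ⟨j, rfl⟩, hj⟩ := h1
      rcases hσj : σ (Sum.inl j) with i | i
      · exact absurd ⟨i, hσj.symm⟩ hj
      · refine mul_eq_zero_of_left (μ.map_eq_zero_of_eq _ (i := e (Sum.inr i))
          (j := e (Sum.inl j)) ?_ (by simp)) _
        simp [hσj, hb]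
  · have h1 : β v = 0 := β.toAlternatingMap.map_linearDependent v hv
    have h2 : contraction ((Equiv.sumComm _ _).trans e) μ v = 0 := by
      ext w
      refine μ.toAlternatingMap.map_linearDependent _ fun hc => hv ?_
      have := hc.comp (fun i => e (Sum.inr i)) (fun i j hij => by simpa using hij)
      simpa [Function.comp_def] using this
    rw [h1, h2]
    ext w
    simp [wedge_apply]

/-- Nondegeneracy of the wedge pairing in complementary degrees. -/
theorem wedge_left_injective {k m N : ℕ} [FiniteDimensional ℝ V] (h : k + m = N)
    (hV : Module.finrank ℝ V = N) {μ : V [⋀^Fin N]→L[ℝ] ℝ} (hμ : μ ≠ 0)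
    {β β' : V [⋀^Fin m]→L[ℝ] ℝ} (hβ : ∀ η : V [⋀^Fin k]→L[ℝ] ℝ, wedge h η β = wedge h η β') :
    β = β' := by
  ext v
  have := hβ (contraction ((Equiv.sumComm _ _).trans (finSumFinEquiv.trans (finCongr h))) μ v)
  rw [wedge_contraction_right h hV, wedge_contraction_right h hV] at this
  exact smul_left_injective ℝ hμ this

theorem wedge_smul_right {k m N : ℕ} (h : k + m = N) (α : V [⋀^Fin k]→L[ℝ] ℝ) (c : ℝ)
    (β : V [⋀^Fin m]→L[ℝ] ℝ) : wedge h α (c • β) = c • wedge h α β := by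
  ext v
  simp only [wedge_apply, ContinuousAlternatingMap.smul_apply, smul_eq_mul, Finset.mul_sum]
  exact Finset.sum_congr rfl fun _ _ => by ring

theorem wedge_sum_right {k m N : ℕ} (h : k + m = N) (α : V [⋀^Fin k]→L[ℝ] ℝ) {ι : Type*}
    (s : Finset ι) (β : ι → V [⋀^Fin m]→L[ℝ] ℝ) :
    wedge h α (∑ i ∈ s, β i) = ∑ i ∈ s, wedge h α (β i) := by
  ext v
  simp only [wedge_apply, ContinuousAlternatingMap.sum_apply, Finset.mul_sum]
  rw [Finset.sum_comm]

theorem wedge_compContinuousLinearMap {W : Type*} [AddCommGroup W] [Module ℝ W] [TopologicalSpace W]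
    {k m N : ℕ} (h : k + m = N) (α : V [⋀^Fin k]→L[ℝ] ℝ) (β : V [⋀^Fin m]→L[ℝ] ℝ) (A : W →L[ℝ] V) :
    wedge h (α.compContinuousLinearMap A) (β.compContinuousLinearMap A) =
      (wedge h α β).compContinuousLinearMap A := by
  ext v
  simp only [ContinuousAlternatingMap.compContinuousLinearMap_apply, wedge_apply,
    Function.comp_def]

end ExteriorAlgebra

/-! ### The inner product of forms in dual frames, and the Hodge dual -/

section HodgeDual

theorem ContinuousAlternatingMap.apply_basis_expansion {V : Type*} [AddCommGroup V] [Module ℝ V]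
    [TopologicalSpace V] {ι : Type*} [Fintype ι] {k : ℕ} (b : Module.Basis ι ℝ V)
    (η : V [⋀^Fin k]→L[ℝ] ℝ) (v : Fin k → V) :
    η v = ∑ a : Fin k → ι, (∏ s, b.repr (v s) (a s)) * η (fun s => b (a s)) := by
  conv_lhs => rw [show v = fun s => ∑ a, b.repr (v s) a • b a from
    funext fun s => (b.sum_repr (v s)).symm]
  have := η.toMultilinearMap.map_sum (fun (s : Fin k) (a : ι) => b.repr (v s) a • b a)
  refine this.trans (Finset.sum_congr rfl fun a _ => ?_)
  exact η.toMultilinearMap.map_smul_univ (fun s => b.repr (v s) (a s)) (fun s => b (a s))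

variable {V : Type*} [AddCommGroup V] [Module ℝ V] {ι : Type*} [Fintype ι] [DecidableEq ι]

/-- The Gram matrix of `B` in a basis, inverted through a pair of dual frames. -/
theorem gram_mul_of_dual_frame (b : Module.Basis ι ℝ V) (B : LinearMap.BilinForm ℝ V)
    {e f : ι → V} (hef : ∀ i j, B (f i) (e j) = if i = j then 1 else 0) :
    (Matrix.of fun a c => B (b a) (b c)) * (b.toMatrix e * (b.toMatrix f).transpose) = 1 := by
  have h : ((b.toMatrix f).transpose * (Matrix.of fun a c => B (b a) (b c))) * b.toMatrix e =
      1 := by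
    ext i j
    rw [Matrix.one_apply, ← hef i j]
    conv_rhs => rw [← b.sum_toMatrix_smul_self f i, ← b.sum_toMatrix_smul_self e j]
    simp only [Matrix.mul_apply, Matrix.transpose_apply, Matrix.of_apply, map_sum, map_smul,
      LinearMap.sum_apply, LinearMap.smul_apply, smul_eq_mul, Finset.sum_mul, Finset.mul_sum]
    refine Finset.sum_congr rfl fun a _ => Finset.sum_congr rfl fun c _ => by ring
  rw [Matrix.mul_assoc, mul_eq_one_comm, Matrix.mul_assoc] at h
  rw [← h]

theorem isUnit_det_gram_of_dual_frame (b : Module.Basis ι ℝ V) (B : LinearMap.BilinForm ℝ V)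
    {e f : ι → V} (hef : ∀ i j, B (f i) (e j) = if i = j then 1 else 0) :
    IsUnit (Matrix.of fun a c => B (b a) (b c)).det :=
  Matrix.isUnit_det_of_right_inverse (gram_mul_of_dual_frame b B hef)

/-- The frame dual to a basis, through the inverse Gram matrix. -/
theorem exists_dual_frame_of_isUnit_det (b : Module.Basis ι ℝ V) (B : LinearMap.BilinForm ℝ V)
    (hu : IsUnit (Matrix.of fun a c => B (b a) (b c)).det) (i j : ι) :
    B (∑ c, (Matrix.of fun a c => B (b a) (b c))⁻¹ i c • b c) (b j) = if i = j then 1 else 0 := by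
  have := congrFun (congrFun (Matrix.nonsing_inv_mul _ hu) i) j
  rw [Matrix.one_apply, Matrix.mul_apply] at this
  simpa using this

variable [TopologicalSpace V]

/-- The inner product of forms does not depend on the basis: any pair of dual frames computes
it. -/
theorem formInner_eq_of_dual_frame (b : Module.Basis ι ℝ V) (B : LinearMap.BilinForm ℝ V)
    {e f : ι → V} (hef : ∀ i j, B (f i) (e j) = if i = j then 1 else 0) {k : ℕ}
    (η ξ : V [⋀^Fin k]→L[ℝ] ℝ) :
    formInner b (fun u v => B u v) η ξ =
      (k.factorial : ℝ)⁻¹ * ∑ i : Fin k → ι, η (fun s => e (i s)) * ξ (fun s => f (i s)) := by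
  rw [formInner, Matrix.inv_eq_right_inv (gram_mul_of_dual_frame b B hef)]
  congr 1
  simp only [Matrix.mul_apply, Matrix.transpose_apply, Finset.prod_univ_sum,
    Fintype.piFinset_univ, Finset.sum_mul]
  have h : ∀ a : Fin k → ι, (∑ c : Fin k → ι, ∑ i : Fin k → ι,
      (∏ s, b.toMatrix e (a s) (i s) * b.toMatrix f (c s) (i s)) *
        η (fun s => b (a s)) * ξ (fun s => b (c s))) = ∑ i : Fin k → ι, ∑ c : Fin k → ι,
      (∏ s, b.toMatrix e (a s) (i s) * b.toMatrix f (c s) (i s)) *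
        η (fun s => b (a s)) * ξ (fun s => b (c s)) := fun a => Finset.sum_comm
  simp only [h]
  rw [Finset.sum_comm]
  refine Finset.sum_congr rfl fun i _ => ?_
  rw [ContinuousAlternatingMap.apply_basis_expansion b η,
    ContinuousAlternatingMap.apply_basis_expansion b ξ, Finset.sum_mul_sum]
  refine Finset.sum_congr rfl fun a _ => Finset.sum_congr rfl fun c _ => ?_
  simp only [Finset.prod_mul_distrib, Module.Basis.toMatrix_apply]
  ring

/-- Naturality of the inner product of forms under linear isomorphisms. -/
theorem formInner_compContinuousLinearMap {W : Type*} [AddCommGroup W] [Module ℝ W]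
    [TopologicalSpace W] (A : V ≃L[ℝ] W) (b : Module.Basis ι ℝ V) (b' : Module.Basis ι ℝ W)
    (B : LinearMap.BilinForm ℝ V) (B' : LinearMap.BilinForm ℝ W)
    (hB : ∀ u v, B u v = B' (A u) (A v)) {e f : ι → W}
    (hef : ∀ i j, B' (f i) (e j) = if i = j then 1 else 0) {k : ℕ} (η ξ : W [⋀^Fin k]→L[ℝ] ℝ) :
    formInner b (fun u v => B u v) (η.compContinuousLinearMap (A : V →L[ℝ] W))
      (ξ.compContinuousLinearMap (A : V →L[ℝ] W)) = formInner b' (fun u v => B' u v) η ξ := by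
  have hef' : ∀ i j, B (A.symm (f i)) (A.symm (e j)) = if i = j then 1 else 0 := fun i j => by
    simp [hB, hef]
  rw [formInner_eq_of_dual_frame b B hef', formInner_eq_of_dual_frame b' B' hef]
  simp [Function.comp_def]

/-- `β` is the Hodge dual of `ξ` for the bilinear form `B` and the volume form `μ`. -/
def IsHodgeDualForm (b : Module.Basis ι ℝ V) (B : V → V → ℝ) {k m N : ℕ} (h : k + m = N)
    (μ : V [⋀^Fin N]→L[ℝ] ℝ) (ξ : V [⋀^Fin k]→L[ℝ] ℝ) (β : V [⋀^Fin m]→L[ℝ] ℝ) : Prop :=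
  ∀ η : V [⋀^Fin k]→L[ℝ] ℝ, wedge h η β = formInner b B η ξ • μ

theorem IsHodgeDualForm.compContinuousLinearMap {W : Type*} [AddCommGroup W] [Module ℝ W]
    [TopologicalSpace W] (A : V ≃L[ℝ] W) {b : Module.Basis ι ℝ V} {b' : Module.Basis ι ℝ W}
    {B : LinearMap.BilinForm ℝ V} {B' : LinearMap.BilinForm ℝ W}
    (hB : ∀ u v, B u v = B' (A u) (A v)) {e f : ι → W}
    (hef : ∀ i j, B' (f i) (e j) = if i = j then 1 else 0) {k m N : ℕ} {h : k + m = N}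
    {μ : W [⋀^Fin N]→L[ℝ] ℝ} {ξ : W [⋀^Fin k]→L[ℝ] ℝ} {β : W [⋀^Fin m]→L[ℝ] ℝ}
    (hβ : IsHodgeDualForm b' (fun u v => B' u v) h μ ξ β) :
    IsHodgeDualForm b (fun u v => B u v) h (μ.compContinuousLinearMap (A : V →L[ℝ] W))
      (ξ.compContinuousLinearMap (A : V →L[ℝ] W)) (β.compContinuousLinearMap (A : V →L[ℝ] W)) := by
  intro η
  obtain ⟨η', rfl⟩ : ∃ η' : W [⋀^Fin k]→L[ℝ] ℝ,
      η = η'.compContinuousLinearMap (A : V →L[ℝ] W) :=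
    ⟨η.compContinuousLinearMap (A.symm : W →L[ℝ] V), by ext v; simp [Function.comp_def]⟩
  rw [wedge_compContinuousLinearMap, hβ η',
    formInner_compContinuousLinearMap A b b' B B' hB hef]
  rfl

/-- The Hodge dual of `ξ` written with a pair `(e, f)` of dual frames. -/
noncomputable def hodgeDualForm {k m N : ℕ} (h : k + m = N) (e f : ι → V) (μ : V [⋀^Fin N]→L[ℝ] ℝ)
    (ξ : V [⋀^Fin k]→L[ℝ] ℝ) : V [⋀^Fin m]→L[ℝ] ℝ :=
  (k.factorial : ℝ)⁻¹ • ∑ i : Fin k → ι,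
    ξ (fun s => f (i s)) • contraction (finSumFinEquiv.trans (finCongr h)) μ (fun s => e (i s))

omit [DecidableEq ι] in
theorem hodgeDualForm_smul {k m N : ℕ} (h : k + m = N) (e f : ι → V) (μ : V [⋀^Fin N]→L[ℝ] ℝ)
    (c : ℝ) (ξ : V [⋀^Fin k]→L[ℝ] ℝ) :
    hodgeDualForm h e f μ (c • ξ) = c • hodgeDualForm h e f μ ξ := by
  simp only [hodgeDualForm, ContinuousAlternatingMap.smul_apply, smul_assoc, ← Finset.smul_sum]
  rw [smul_comm]

/-- Each summand is evaluated by `wedge_contraction_left`, and the sum is the inner product in dual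
frames. -/
theorem isHodgeDualForm_hodgeDualForm [FiniteDimensional ℝ V] {k m N : ℕ} (h : k + m = N)
    (hV : Module.finrank ℝ V = N) (b : Module.Basis ι ℝ V) (B : LinearMap.BilinForm ℝ V)
    {e f : ι → V} (hef : ∀ i j, B (f i) (e j) = if i = j then 1 else 0)
    (μ : V [⋀^Fin N]→L[ℝ] ℝ) (ξ : V [⋀^Fin k]→L[ℝ] ℝ) :
    IsHodgeDualForm b (fun u v => B u v) h μ ξ (hodgeDualForm h e f μ ξ) := by
  intro η
  rw [hodgeDualForm, wedge_smul_right, wedge_sum_right, formInner_eq_of_dual_frame b B hef]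
  simp only [wedge_smul_right, wedge_contraction_left h hV, smul_smul]
  rw [mul_smul, Finset.sum_smul]
  simp only [mul_comm]

/-- Existence and uniqueness of the Hodge dual, with an explicit formula in dual frames. -/
theorem isHodgeDualForm_iff [FiniteDimensional ℝ V] {k m N : ℕ} (h : k + m = N)
    (hV : Module.finrank ℝ V = N) (b : Module.Basis ι ℝ V) (B : LinearMap.BilinForm ℝ V)
    {e f : ι → V} (hef : ∀ i j, B (f i) (e j) = if i = j then 1 else 0)
    {μ : V [⋀^Fin N]→L[ℝ] ℝ} (hμ : μ ≠ 0) (ξ : V [⋀^Fin k]→L[ℝ] ℝ) (β : V [⋀^Fin m]→L[ℝ] ℝ) :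
    IsHodgeDualForm b (fun u v => B u v) h μ ξ β ↔ β = hodgeDualForm h e f μ ξ := by
  have h0 := isHodgeDualForm_hodgeDualForm h hV b B hef μ ξ
  refine ⟨fun hβ => wedge_left_injective h hV hμ fun η => (hβ η).trans (h0 η).symm, ?_⟩
  rintro rfl
  exact h0

end HodgeDual

/-! ### Orthonormal bases of a bilinear form -/

section Orthonormal

/-- A unit vector extends to an orthonormal basis. -/
theorem LinearMap.BilinForm.exists_orthonormal_basis_extending {n : ℕ} {V : Type*} [AddCommGroup V]
    [Module ℝ V] [FiniteDimensional ℝ V] (hV : Module.finrank ℝ V = n + 1)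
    (H : LinearMap.BilinForm ℝ V) (hsymm : ∀ u v, H u v = H v u) (hnonneg : ∀ u, 0 ≤ H u u)
    (hdef : ∀ u, H u u = 0 → u = 0) {x : V} (hx : H x x = 1) :
    ∃ e : Module.Basis (Fin (n + 1)) ℝ V, e 0 = x ∧
      ∀ i j, H (e i) (e j) = if i = j then 1 else 0 := by
  let c : InnerProductSpace.Core ℝ V :=
    { inner := fun u v => H u v
      conj_inner_symm := fun u v => hsymm v u
      re_inner_nonneg := hnonneg
      add_left := by simp
      smul_left := by simp
      definite := hdef }
  let := c.toNormedAddCommGroup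
  let : InnerProductSpace ℝ V := InnerProductSpace.ofCore c.toCore
  have hinner : ∀ u v : V, inner ℝ u v = H u v := fun _ _ => rfl
  obtain ⟨b, hb⟩ := Orthonormal.exists_orthonormalBasis_extension_of_card_eq (𝕜 := ℝ) (E := V)
    (ι := Fin (n + 1)) (by simpa using hV) (v := fun _ => x) (s := {0}) (by
      rw [orthonormal_iff_ite]
      intro i j
      rw [Subsingleton.elim i j, if_pos rfl]
      exact (hinner x x).trans hx)
  refine ⟨b.toBasis, by simpa using hb 0 rfl, fun i j => ?_⟩
  rw [← hinner]
  simpa using orthonormal_iff_ite.1 b.orthonormal i j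

end Orthonormal

/-! ### Smoothness of form-valued maps -/

section FormValuedMaps

variable {E : Type*} [NormedAddCommGroup E] [NormedSpace ℝ E] [FiniteDimensional ℝ E]
  {S : Type*} [NormedAddCommGroup S] [NormedSpace ℝ S] {k : ℕ}

/-- On a finite-dimensional space a form-valued map is as smooth as its components. -/
theorem contDiffAt_form_iff {r : ℕ∞ω} {F : S → E [⋀^Fin k]→L[ℝ] ℝ} {x : S} :
    ContDiffAt ℝ r F x ↔ ∀ v : Fin k → E, ContDiffAt ℝ r (fun y => F y v) x := by
  refine ⟨fun h v => (ContinuousAlternatingMap.apply ℝ E ℝ v).contDiff.contDiffAt.comp x h,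
    fun h => ?_⟩
  let b := Module.finBasis ℝ E
  -- The components determine a form, so they have a linear, hence continuous, left inverse.
  let ev : (E [⋀^Fin k]→L[ℝ] ℝ) →ₗ[ℝ] ((Fin k → Fin (Module.finrank ℝ E)) → ℝ) :=
    { toFun := fun α a => α fun s => b (a s)
      map_add' := fun _ _ => rfl
      map_smul' := fun _ _ => rfl }
  have hev : LinearMap.ker ev = ⊥ := by
    refine LinearMap.ker_eq_bot'.2 fun α hα => ?_
    ext v
    rw [ContinuousAlternatingMap.apply_basis_expansion b]
    exact Finset.sum_eq_zero fun a _ => mul_eq_zero_of_right _ (congrFun hα a)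
  obtain ⟨l, hl⟩ := ev.exists_leftInverse_of_injective hev
  have hF : F = fun y => LinearMap.toContinuousLinearMap l (ev (F y)) := by
    ext1 y
    exact (LinearMap.congr_fun hl (F y)).symm
  rw [hF]
  refine (LinearMap.toContinuousLinearMap l).contDiff.contDiffAt.comp x ?_
  exact contDiffAt_pi.2 fun a => h fun s => b (a s)

theorem ContDiffAt.form_apply {r : ℕ∞ω} {F : S → E [⋀^Fin k]→L[ℝ] ℝ} {v : Fin k → S → E} {x : S}
    (hF : ContDiffAt ℝ r F x) (hv : ∀ i, ContDiffAt ℝ r (v i) x) :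
    ContDiffAt ℝ r (fun y => F y fun i => v i y) x := by
  let b := Module.finBasis ℝ E
  have h : (fun y => F y fun i => v i y) = fun y => ∑ a : Fin k → Fin (Module.finrank ℝ E),
      (∏ s, b.repr (v s y) (a s)) * F y (fun s => b (a s)) := by
    ext1 y
    exact ContinuousAlternatingMap.apply_basis_expansion b _ _
  rw [h]
  refine ContDiffAt.sum fun a _ => ContDiffAt.mul (contDiffAt_prod fun s _ => ?_)
    (contDiffAt_form_iff.1 hF _)
  exact (LinearMap.toContinuousLinearMap (b.coord (a s))).contDiff.contDiffAt.comp x (hv s)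

theorem ContDiffAt.form_comp {E' : Type*} [NormedAddCommGroup E'] [NormedSpace ℝ E']
    [FiniteDimensional ℝ E'] {r : ℕ∞ω} {F : S → E [⋀^Fin k]→L[ℝ] ℝ} {A : S → E' →L[ℝ] E} {x : S}
    (hF : ContDiffAt ℝ r F x) (hA : ContDiffAt ℝ r A x) :
    ContDiffAt ℝ r (fun y => (F y).compContinuousLinearMap (A y)) x := by
  refine contDiffAt_form_iff.2 fun v => ?_
  exact hF.form_apply (v := fun i y => A y (v i)) fun i => hA.clm_apply contDiffAt_const

theorem ContDiffAt.wedge {r : ℕ∞ω} {m N : ℕ} (h : k + m = N) {α : S → E [⋀^Fin k]→L[ℝ] ℝ}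
    {β : S → E [⋀^Fin m]→L[ℝ] ℝ} {x : S} (hα : ContDiffAt ℝ r α x) (hβ : ContDiffAt ℝ r β x) :
    ContDiffAt ℝ r (fun y => wedge h (α y) (β y)) x := by
  refine contDiffAt_form_iff.2 fun v => ?_
  simp only [wedge_apply]
  exact contDiffAt_const.mul (ContDiffAt.sum fun σ _ => contDiffAt_const.mul
    ((contDiffAt_form_iff.1 hα _).mul (contDiffAt_form_iff.1 hβ _)))

end FormValuedMaps

/-! ### Forms on manifolds in charts -/

section Charts

variable {N : ℕ} {X : Type*} [TopologicalSpace X] [ChartedSpace (EuclideanSpace ℝ (Fin N)) X]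
  [IsManifold (𝓡 N) ∞ X]

theorem isManifold_one : IsManifold (𝓡 N) 1 X := IsManifold.of_le (n := ∞) (by simp)

theorem mdifferentiableAt_extChartAt_symm {x₀ : X} {y : EuclideanSpace ℝ (Fin N)}
    (hy : y ∈ (extChartAt (𝓡 N) x₀).target) :
    MDifferentiableAt 𝓘(ℝ, EuclideanSpace ℝ (Fin N)) (𝓡 N) (extChartAt (𝓡 N) x₀).symm y :=
  ((contMDiffOn_extChartAt_symm (n := ∞) x₀).contMDiffAt
    (extChartAt_target_mem_nhds' hy)).mdifferentiableAt (by simp)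

/-- A field of forms is smooth iff at each point its representative in the chart there is. -/
theorem isSmoothForm_iff {k : ℕ} {ξ : DForm N X k} :
    IsSmoothForm ξ ↔
      ∀ x, ContDiffAt ℝ ∞ (formInChart ξ x) (extChartAt (𝓡 N) x x) := by
  have := isManifold_one (N := N) (X := X)
  refine forall_congr' fun x => ?_
  rw [contMDiffAt_section, contMDiffAt_iff_source, ModelWithCorners.range_eq_univ,
    contMDiffWithinAt_univ, contMDiffAt_iff_contDiffAt]
  suffices h : (fun x' => (trivializationAt (EuclideanSpace ℝ (Fin N) [⋀^Fin k]→L[ℝ] ℝ)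
      (fun x : X => TangentSpace (𝓡 N) x [⋀^Fin k]→L[ℝ] (Bundle.Trivial X ℝ x)) x ⟨x', ξ x'⟩).2) ∘
      (extChartAt (𝓡 N) x).symm =ᶠ[𝓝 (extChartAt (𝓡 N) x x)] formInChart ξ x from
    ⟨fun hξ => hξ.congr_of_eventuallyEq h.symm, fun hξ => hξ.congr_of_eventuallyEq h⟩
  filter_upwards [extChartAt_target_mem_nhds (I := 𝓡 N) x] with y hy
  have hy' : (extChartAt (𝓡 N) x).symm y ∈ (chartAt (EuclideanSpace ℝ (Fin N)) x).source := by
    simpa using (extChartAt (𝓡 N) x).map_target hy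
  have h1 := TangentBundle.symmL_trivializationAt (I := 𝓡 N) hy'
  rw [(extChartAt (𝓡 N) x).right_inv hy, ModelWithCorners.range_eq_univ, mfderivWithin_univ] at h1
  ext v
  simp only [Function.comp_apply, formInChart,
    FiberBundle.trivializationAt_continuousAlternatingMap_apply,
    ContinuousAlternatingMap.inCoordinates, h1]
  simp
  rfl

end Charts

/-! ### Pullbacks in charts -/

section Pullback

variable {N : ℕ} {X : Type*} [TopologicalSpace X] [ChartedSpace (EuclideanSpace ℝ (Fin N)) X]
  {N' : ℕ} {Y : Type*} [TopologicalSpace Y] [ChartedSpace (EuclideanSpace ℝ (Fin N')) Y]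

/-- The coordinate expression of `f` in the preferred charts at `x₀` and `y₀`. -/
noncomputable def mapInCharts (f : X → Y) (x₀ : X) (y₀ : Y) (u : EuclideanSpace ℝ (Fin N)) :
    EuclideanSpace ℝ (Fin N') :=
  extChartAt (𝓡 N') y₀ (f ((extChartAt (𝓡 N) x₀).symm u))

variable [IsManifold (𝓡 N) ∞ X] [IsManifold (𝓡 N') ∞ Y]

omit [IsManifold (𝓡 N) ∞ X] in
/-- The point `(extChartAt x₀).symm (extChartAt x₀ x)` in the definition of `formInChart` is
replaced by `x`. -/
theorem formInChart_extChartAt {k : ℕ} (ξ : DForm N X k) (x₀ : X) {x : X}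
    (hx : x ∈ (chartAt (EuclideanSpace ℝ (Fin N)) x₀).source) :
    formInChart ξ x₀ (extChartAt (𝓡 N) x₀ x) =
      (ξ x : EuclideanSpace ℝ (Fin N) [⋀^Fin k]→L[ℝ] ℝ).compContinuousLinearMap
        (mfderiv 𝓘(ℝ, EuclideanSpace ℝ (Fin N)) (𝓡 N) (extChartAt (𝓡 N) x₀).symm
          (extChartAt (𝓡 N) x₀ x) : EuclideanSpace ℝ (Fin N) →L[ℝ] EuclideanSpace ℝ (Fin N)) := by
  have h : (extChartAt (𝓡 N) x₀).symm (extChartAt (𝓡 N) x₀ x) = x :=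
    (extChartAt (𝓡 N) x₀).left_inv (by simpa using hx)
  have key : ∀ z, z = x → (ξ z : EuclideanSpace ℝ (Fin N) [⋀^Fin k]→L[ℝ] ℝ) = ξ x := by
    rintro z rfl; rfl
  exact congrArg (fun α : EuclideanSpace ℝ (Fin N) [⋀^Fin k]→L[ℝ] ℝ =>
    α.compContinuousLinearMap (mfderiv 𝓘(ℝ, EuclideanSpace ℝ (Fin N)) (𝓡 N)
      (extChartAt (𝓡 N) x₀).symm (extChartAt (𝓡 N) x₀ x) :
      EuclideanSpace ℝ (Fin N) →L[ℝ] EuclideanSpace ℝ (Fin N))) (key _ h)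

theorem mfderiv_symm_comp_mfderiv_extChartAt (x₀ : X) {x : X}
    (hx : x ∈ (chartAt (EuclideanSpace ℝ (Fin N)) x₀).source) (v : EuclideanSpace ℝ (Fin N)) :
    (mfderiv 𝓘(ℝ, EuclideanSpace ℝ (Fin N)) (𝓡 N) (extChartAt (𝓡 N) x₀).symm
      (extChartAt (𝓡 N) x₀ x) : EuclideanSpace ℝ (Fin N) →L[ℝ] EuclideanSpace ℝ (Fin N))
      ((mfderiv (𝓡 N) 𝓘(ℝ, EuclideanSpace ℝ (Fin N)) (extChartAt (𝓡 N) x₀) x :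
        EuclideanSpace ℝ (Fin N) →L[ℝ] EuclideanSpace ℝ (Fin N)) v) = v := by
  have := isManifold_one (N := N) (X := X)
  have h := mfderivWithin_extChartAt_symm_comp_mfderiv_extChartAt' (I := 𝓡 N) (x := x₀) (y := x)
    (by simpa using hx)
  rw [ModelWithCorners.range_eq_univ, mfderivWithin_univ] at h
  exact congrArg (fun A : EuclideanSpace ℝ (Fin N) →L[ℝ] EuclideanSpace ℝ (Fin N) => A v) h

theorem mfderiv_extChartAt_comp_mfderiv_symm (x₀ : X) {x : X}
    (hx : x ∈ (chartAt (EuclideanSpace ℝ (Fin N)) x₀).source) (v : EuclideanSpace ℝ (Fin N)) :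
    (mfderiv (𝓡 N) 𝓘(ℝ, EuclideanSpace ℝ (Fin N)) (extChartAt (𝓡 N) x₀) x :
        EuclideanSpace ℝ (Fin N) →L[ℝ] EuclideanSpace ℝ (Fin N))
      ((mfderiv 𝓘(ℝ, EuclideanSpace ℝ (Fin N)) (𝓡 N) (extChartAt (𝓡 N) x₀).symm
      (extChartAt (𝓡 N) x₀ x) : EuclideanSpace ℝ (Fin N) →L[ℝ] EuclideanSpace ℝ (Fin N)) v) =
      v := by
  have := isManifold_one (N := N) (X := X)
  have h := mfderiv_extChartAt_comp_mfderivWithin_extChartAt_symm' (I := 𝓡 N) (x := x₀) (y := x)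
    (by simpa using hx)
  rw [ModelWithCorners.range_eq_univ, mfderivWithin_univ] at h
  exact congrArg (fun A : EuclideanSpace ℝ (Fin N) →L[ℝ] EuclideanSpace ℝ (Fin N) => A v) h

theorem fderiv_mapInCharts {f : X → Y} {x₀ : X} {y₀ : Y} {x : X}
    (hx : x ∈ (chartAt (EuclideanSpace ℝ (Fin N)) x₀).source)
    (hfx : f x ∈ (chartAt (EuclideanSpace ℝ (Fin N')) y₀).source)
    (hf : MDifferentiableAt (𝓡 N) (𝓡 N') f x) :
    fderiv ℝ (mapInCharts f x₀ y₀) (extChartAt (𝓡 N) x₀ x) =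
      (mfderiv (𝓡 N') 𝓘(ℝ, EuclideanSpace ℝ (Fin N')) (extChartAt (𝓡 N') y₀) (f x) :
        EuclideanSpace ℝ (Fin N') →L[ℝ] EuclideanSpace ℝ (Fin N')) ∘L
      ((mfderiv (𝓡 N) (𝓡 N') f x :
        EuclideanSpace ℝ (Fin N) →L[ℝ] EuclideanSpace ℝ (Fin N')) ∘L
      (mfderiv 𝓘(ℝ, EuclideanSpace ℝ (Fin N)) (𝓡 N) (extChartAt (𝓡 N) x₀).symm
        (extChartAt (𝓡 N) x₀ x) : EuclideanSpace ℝ (Fin N) →L[ℝ] EuclideanSpace ℝ (Fin N))) := by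
  have := isManifold_one (N := N') (X := Y)
  have hx' : x ∈ (extChartAt (𝓡 N) x₀).source := by simpa using hx
  have h1 := (mdifferentiableAt_extChartAt_symm
    ((extChartAt (𝓡 N) x₀).map_source hx')).hasMFDerivAt
  have hl := (extChartAt (𝓡 N) x₀).left_inv hx'
  have h2 : HasMFDerivAt (𝓡 N) (𝓡 N') f
    ((extChartAt (𝓡 N) x₀).symm (extChartAt (𝓡 N) x₀ x)) (mfderiv (𝓡 N) (𝓡 N') f x :
        EuclideanSpace ℝ (Fin N) →L[ℝ] EuclideanSpace ℝ (Fin N')) := by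
    rw [hl]; exact hf.hasMFDerivAt
  have h3 : HasMFDerivAt (𝓡 N') 𝓘(ℝ, EuclideanSpace ℝ (Fin N')) (extChartAt (𝓡 N') y₀)
      (f ((extChartAt (𝓡 N) x₀).symm (extChartAt (𝓡 N) x₀ x)))
      (mfderiv (𝓡 N') 𝓘(ℝ, EuclideanSpace ℝ (Fin N')) (extChartAt (𝓡 N') y₀) (f x) :
        EuclideanSpace ℝ (Fin N') →L[ℝ] EuclideanSpace ℝ (Fin N')) := by
    rw [hl]; exact (mdifferentiableAt_extChartAt hfx).hasMFDerivAt
  have h4 := HasMFDerivAt.comp (f := (extChartAt (𝓡 N) x₀).symm) (g := f)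
    (extChartAt (𝓡 N) x₀ x) h2 h1
  have h5 := HasMFDerivAt.comp (f := f ∘ (extChartAt (𝓡 N) x₀).symm) (g := extChartAt (𝓡 N') y₀)
    (extChartAt (𝓡 N) x₀ x) h3 h4
  refine HasFDerivAt.fderiv ?_
  exact h5.hasFDerivAt

theorem formInChart_formPullback {k : ℕ} (ξ : DForm N' Y k) {f : X → Y} {x₀ : X} {y₀ : Y} {x : X}
    (hx : x ∈ (chartAt (EuclideanSpace ℝ (Fin N)) x₀).source)
    (hfx : f x ∈ (chartAt (EuclideanSpace ℝ (Fin N')) y₀).source)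
    (hf : MDifferentiableAt (𝓡 N) (𝓡 N') f x) :
    formInChart (formPullback f ξ) x₀ (extChartAt (𝓡 N) x₀ x) =
      (formInChart ξ y₀ (mapInCharts f x₀ y₀ (extChartAt (𝓡 N) x₀ x))).compContinuousLinearMap
        (fderiv ℝ (mapInCharts f x₀ y₀) (extChartAt (𝓡 N) x₀ x)) := by
  have hl := (extChartAt (𝓡 N) x₀).left_inv (x := x) (by simpa using hx)
  rw [fderiv_mapInCharts hx hfx hf, formInChart_extChartAt _ _ hx, mapInCharts, hl,
    formInChart_extChartAt _ _ hfx]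
  ext v
  exact congrArg (ξ (f x) : EuclideanSpace ℝ (Fin N') [⋀^Fin k]→L[ℝ] ℝ)
    (funext fun i => (mfderiv_symm_comp_mfderiv_extChartAt y₀ hfx _).symm)

theorem contDiffAt_mapInCharts {f : ℝ → X → Y} {x₀ : X} {y₀ : Y} {x : X} {s : ℝ}
    (hx : x ∈ (chartAt (EuclideanSpace ℝ (Fin N)) x₀).source)
    (hfx : f s x ∈ (chartAt (EuclideanSpace ℝ (Fin N')) y₀).source)
    (hf : ContMDiffAt (𝓘(ℝ, ℝ).prod (𝓡 N)) (𝓡 N') ∞ (Function.uncurry f) (s, x)) :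
    ContDiffAt ℝ ∞ (fun q : ℝ × EuclideanSpace ℝ (Fin N) =>
        mapInCharts (N := N) (N' := N') (f q.1) x₀ y₀ q.2)
      (s, extChartAt (𝓡 N) x₀ x) := by
  have hx' : x ∈ (extChartAt (𝓡 N) x₀).source := by simpa using hx
  rw [← contMDiffAt_iff_contDiffAt]
  have h1 : ContMDiffAt 𝓘(ℝ, EuclideanSpace ℝ (Fin N)) (𝓡 N) ∞ (extChartAt (𝓡 N) x₀).symm
      (extChartAt (𝓡 N) x₀ x) :=
    (contMDiffOn_extChartAt_symm (n := ∞) x₀).contMDiffAt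
      (extChartAt_target_mem_nhds' ((extChartAt (𝓡 N) x₀).map_source hx'))
  have h2 : ContMDiffAt 𝓘(ℝ, ℝ × EuclideanSpace ℝ (Fin N)) (𝓘(ℝ, ℝ).prod (𝓡 N)) ∞
      (fun q : ℝ × EuclideanSpace ℝ (Fin N) => (q.1, (extChartAt (𝓡 N) x₀).symm q.2))
      (s, extChartAt (𝓡 N) x₀ x) :=
    contDiffAt_fst.contMDiffAt.prodMk
      (ContMDiffAt.comp (s, extChartAt (𝓡 N) x₀ x) h1 contDiffAt_snd.contMDiffAt)
  have hl := (extChartAt (𝓡 N) x₀).left_inv hx'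
  refine ContMDiffAt.comp (I' := 𝓡 N') (g := extChartAt (𝓡 N') y₀) (s, extChartAt (𝓡 N) x₀ x) ?_
    (ContMDiffAt.comp (I' := 𝓘(ℝ, ℝ).prod (𝓡 N)) (I'' := 𝓡 N') (g := Function.uncurry f)
      (s, extChartAt (𝓡 N) x₀ x) ?_ h2)
  · refine contMDiffAt_extChartAt' ?_
    simpa only [hl] using hfx
  · simpa only [hl] using hf

end Pullback

/-! ### Pullbacks of smooth forms -/

section SmoothPullback

theorem two_le_infty : (2 : ℕ∞ω) ≤ ∞ := WithTop.coe_le_coe.2 (le_top : (2 : ℕ∞) ≤ ⊤)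

variable {N : ℕ} {X : Type*} [TopologicalSpace X] [ChartedSpace (EuclideanSpace ℝ (Fin N)) X]
  {N' : ℕ} {Y : Type*} [TopologicalSpace Y] [ChartedSpace (EuclideanSpace ℝ (Fin N')) Y]

theorem formPullback_id {k : ℕ} (ξ : DForm N X k) : formPullback (fun x => x) ξ = ξ := by
  funext x
  ext v
  have : mfderiv (𝓡 N) (𝓡 N) (fun x : X => x) x = ContinuousLinearMap.id ℝ _ := mfderiv_id
  simp [formPullback, this]

theorem formPullback_comp {N'' : ℕ} {Z : Type*} [TopologicalSpace Z]
    [ChartedSpace (EuclideanSpace ℝ (Fin N'')) Z] {k : ℕ} (ξ : DForm N'' Z k)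
    {h : Y → Z} {f : X → Y}
    (hh : MDifferentiable (𝓡 N') (𝓡 N'') h) (hf : MDifferentiable (𝓡 N) (𝓡 N') f) :
    formPullback (N := N) (fun x => h (f x)) ξ =
      formPullback (N := N) f (formPullback (N := N') h ξ) := by
  funext x
  have := mfderiv_comp x (hh (f x)) (hf x)
  rw [Function.comp_def] at this
  simp only [formPullback, this]
  rfl

variable [IsManifold (𝓡 N) ∞ X] [IsManifold (𝓡 N') ∞ Y]

/-- Near a point, the representative of the pullback along a family `f` of maps is the pullback of
the representative along the coordinate expression of `f`, jointly in the parameter. -/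
theorem formInChart_formPullback_eventuallyEq {k : ℕ} (ξ : DForm N' Y k) {f : ℝ → X → Y}
    (hf : ContMDiff (𝓘(ℝ, ℝ).prod (𝓡 N)) (𝓡 N') ∞ (Function.uncurry f))
    {x₀ : X} {y₀ : Y} {x : X} {s : ℝ}
    (hx : x ∈ (chartAt (EuclideanSpace ℝ (Fin N)) x₀).source)
    (hfx : f s x ∈ (chartAt (EuclideanSpace ℝ (Fin N')) y₀).source) :
    (fun q : ℝ × EuclideanSpace ℝ (Fin N) => formInChart (formPullback (f q.1) ξ) x₀ q.2)
      =ᶠ[𝓝 (s, extChartAt (𝓡 N) x₀ x)] fun q =>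
        (formInChart ξ y₀ (mapInCharts (f q.1) x₀ y₀ q.2)).compContinuousLinearMap
          (fderiv ℝ (mapInCharts (f q.1) x₀ y₀) q.2) := by
  have hx' : x ∈ (extChartAt (𝓡 N) x₀).source := by simpa using hx
  have hl := (extChartAt (𝓡 N) x₀).left_inv hx'
  have hcont : ContinuousAt (fun q : ℝ × EuclideanSpace ℝ (Fin N) =>
      f q.1 ((extChartAt (𝓡 N) x₀).symm q.2)) (s, extChartAt (𝓡 N) x₀ x) := by
    have h1 : ContinuousAt (fun q : ℝ × EuclideanSpace ℝ (Fin N) =>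
        (q.1, (extChartAt (𝓡 N) x₀).symm q.2)) (s, extChartAt (𝓡 N) x₀ x) :=
      continuousAt_fst.prodMk (ContinuousAt.comp (f := Prod.snd)
        (continuousAt_extChartAt_symm' hx') continuousAt_snd)
    exact ContinuousAt.comp (g := Function.uncurry f) hf.continuous.continuousAt h1
  have h2 := hcont.preimage_mem_nhds
    ((chartAt (EuclideanSpace ℝ (Fin N')) y₀).open_source.mem_nhds (by simpa only [hl] using hfx))
  have h3 : {q : ℝ × EuclideanSpace ℝ (Fin N) | q.2 ∈ (extChartAt (𝓡 N) x₀).target} ∈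
      𝓝 (s, extChartAt (𝓡 N) x₀ x) :=
    continuousAt_snd.preimage_mem_nhds
      (extChartAt_target_mem_nhds' ((extChartAt (𝓡 N) x₀).map_source hx'))
  filter_upwards [h2, h3] with q hq1 hq2
  have hq : (extChartAt (𝓡 N) x₀).symm q.2 ∈ (chartAt (EuclideanSpace ℝ (Fin N)) x₀).source := by
    simpa using (extChartAt (𝓡 N) x₀).map_target hq2
  have hfq : MDifferentiableAt (𝓡 N) (𝓡 N') (f q.1) ((extChartAt (𝓡 N) x₀).symm q.2) := by
    have h4 : ContMDiff (𝓡 N) (𝓘(ℝ, ℝ).prod (𝓡 N)) ∞ (fun x : X => (q.1, x)) :=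
      contMDiff_const.prodMk contMDiff_id
    exact ((hf.comp h4) _).mdifferentiableAt (by simp)
  have := formInChart_formPullback ξ hq hq1 hfq
  rwa [(extChartAt (𝓡 N) x₀).right_inv hq2] at this

/-- Pulling a smooth form back along a smooth family of maps is jointly smooth in the parameter and
the point. -/
theorem contDiffAt_formInChart_formPullback {k : ℕ} {ξ : DForm N' Y k} {f : ℝ → X → Y}
    (hf : ContMDiff (𝓘(ℝ, ℝ).prod (𝓡 N)) (𝓡 N') ∞ (Function.uncurry f))
    {x₀ : X} {y₀ : Y} {x : X} {s : ℝ}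
    (hx : x ∈ (chartAt (EuclideanSpace ℝ (Fin N)) x₀).source)
    (hfx : f s x ∈ (chartAt (EuclideanSpace ℝ (Fin N')) y₀).source)
    (hξ : ContDiffAt ℝ ∞ (formInChart ξ y₀) (extChartAt (𝓡 N') y₀ (f s x))) :
    ContDiffAt ℝ ∞
      (fun q : ℝ × EuclideanSpace ℝ (Fin N) => formInChart (formPullback (f q.1) ξ) x₀ q.2)
      (s, extChartAt (𝓡 N) x₀ x) := by
  refine ContDiffAt.congr_of_eventuallyEq ?_
    (formInChart_formPullback_eventuallyEq (y₀ := y₀) ξ hf hx hfx)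
  have hF := contDiffAt_mapInCharts hx hfx (hf (s, x))
  have hl := (extChartAt (𝓡 N) x₀).left_inv (x := x) (by simpa using hx)
  refine ContDiffAt.form_comp ?_ ?_
  · refine ContDiffAt.comp (g := formInChart ξ y₀) (s, extChartAt (𝓡 N) x₀ x) ?_ hF
    simpa only [mapInCharts, hl] using hξ
  · refine ContDiffAt.fderiv (n := ∞)
      (f := fun (q : ℝ × EuclideanSpace ℝ (Fin N)) u => mapInCharts (f q.1) x₀ y₀ u)
      (g := Prod.snd) ?_ contDiffAt_snd (by simp)
    exact ContDiffAt.comp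
      (g := fun q : ℝ × EuclideanSpace ℝ (Fin N) => mapInCharts (N' := N') (f q.1) x₀ y₀ q.2)
      (f := fun r : (ℝ × EuclideanSpace ℝ (Fin N)) × EuclideanSpace ℝ (Fin N) => (r.1.1, r.2))
      ((s, extChartAt (𝓡 N) x₀ x), extChartAt (𝓡 N) x₀ x) hF
      ((contDiffAt_fst.comp _ contDiffAt_fst).prodMk contDiffAt_snd)

/-- A smooth form is smooth in every preferred chart, at every point of it. The change of charts is
the pullback along the identity, in charts at two different points. -/
theorem IsSmoothForm.contDiffAt_formInChart {k : ℕ} {ξ : DForm N X k} (hξ : IsSmoothForm ξ)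
    {x₀ : X} {x : X} (hx : x ∈ (chartAt (EuclideanSpace ℝ (Fin N)) x₀).source) :
    ContDiffAt ℝ ∞ (formInChart ξ x₀) (extChartAt (𝓡 N) x₀ x) := by
  have h := contDiffAt_formInChart_formPullback (ξ := ξ) (f := fun (_ : ℝ) (x : X) => x)
    contMDiff_snd (x₀ := x₀) (y₀ := x) (x := x) (s := 0) hx (mem_chart_source _ x)
    (isSmoothForm_iff.1 hξ x)
  simp only [formPullback_id] at h
  exact h.comp (f := fun u => ((0 : ℝ), u)) _ (contDiffAt_const.prodMk contDiffAt_id)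

theorem IsSmoothForm.pullback {k : ℕ} {ξ : DForm N' Y k} (hξ : IsSmoothForm ξ) {f : X → Y}
    (hf : ContMDiff (𝓡 N) (𝓡 N') ∞ f) : IsSmoothForm (N := N) (formPullback f ξ) := by
  refine isSmoothForm_iff.2 fun x => ?_
  have h := contDiffAt_formInChart_formPullback (ξ := ξ) (f := fun (_ : ℝ) (x : X) => f x)
    (hf.comp contMDiff_snd) (x₀ := x) (y₀ := f x) (x := x) (s := 0) (mem_chart_source _ x)
    (mem_chart_source _ (f x)) (isSmoothForm_iff.1 hξ (f x))
  exact h.comp (f := fun u => ((0 : ℝ), u)) _ (contDiffAt_const.prodMk contDiffAt_id)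

/-! ### The de Rham differential -/

theorem isBoundedLinearMap_alternatizeUncurryFin {E : Type*} [NormedAddCommGroup E]
    [NormedSpace ℝ E] {k : ℕ} :
    IsBoundedLinearMap ℝ fun A : E →L[ℝ] E [⋀^Fin k]→L[ℝ] ℝ =>
      ContinuousAlternatingMap.alternatizeUncurryFin A where
  map_add := ContinuousAlternatingMap.alternatizeUncurryFin_add
  map_smul := ContinuousAlternatingMap.alternatizeUncurryFin_smul
  bound := ⟨k + 1, by positivity, ContinuousAlternatingMap.norm_alternatizeUncurryFin_le⟩

theorem extDeriv_formInChart_formPullback {k : ℕ} {ξ : DForm N' Y k} (hξ : IsSmoothForm ξ)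
    {f : X → Y} (hf : ContMDiff (𝓡 N) (𝓡 N') ∞ f) {x₀ : X} {y₀ : Y} {x : X}
    (hx : x ∈ (chartAt (EuclideanSpace ℝ (Fin N)) x₀).source)
    (hfx : f x ∈ (chartAt (EuclideanSpace ℝ (Fin N')) y₀).source) :
    extDeriv (formInChart (formPullback f ξ) x₀) (extChartAt (𝓡 N) x₀ x) =
      (extDeriv (formInChart ξ y₀) (extChartAt (𝓡 N') y₀ (f x))).compContinuousLinearMap
        (fderiv ℝ (mapInCharts f x₀ y₀) (extChartAt (𝓡 N) x₀ x)) := by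
  have hf' : ContMDiff (𝓘(ℝ, ℝ).prod (𝓡 N)) (𝓡 N') ∞
      (Function.uncurry fun (_ : ℝ) (x : X) => f x) := hf.comp contMDiff_snd
  have h0 : ContinuousAt (fun u => ((0 : ℝ), u)) (extChartAt (𝓡 N) x₀ x) :=
    continuousAt_const.prodMk continuousAt_id
  have h1 := h0.eventually
    (formInChart_formPullback_eventuallyEq (s := 0) (x₀ := x₀) (y₀ := y₀) ξ hf' hx hfx)
  have hl := (extChartAt (𝓡 N) x₀).left_inv (x := x) (by simpa using hx)
  have h2 : mapInCharts f x₀ y₀ (extChartAt (𝓡 N) x₀ x) = extChartAt (𝓡 N') y₀ (f x) := by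
    rw [mapInCharts, hl]
  have h3 : ContDiffAt ℝ ∞ (mapInCharts (N := N) (N' := N') f x₀ y₀) (extChartAt (𝓡 N) x₀ x) :=
    (contDiffAt_mapInCharts (s := 0) hx hfx (hf' (0, x))).comp (f := fun u => ((0 : ℝ), u)) _
      (contDiffAt_const.prodMk contDiffAt_id)
  rw [Filter.EventuallyEq.extDeriv_eq h1,
    extDeriv_pullback (r := ∞) ?_ h3 (by simpa using two_le_infty), h2]
  rw [h2]
  exact (hξ.contDiffAt_formInChart hfx).differentiableAt (by simp)

/-- The differential may be computed in any preferred chart, although `formD` uses the chart at the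
point. -/
theorem formInChart_formD {k : ℕ} {ξ : DForm N X k} (hξ : IsSmoothForm ξ) {x₀ x : X}
    (hx : x ∈ (chartAt (EuclideanSpace ℝ (Fin N)) x₀).source) :
    formInChart (formD ξ) x₀ (extChartAt (𝓡 N) x₀ x) =
      extDeriv (formInChart ξ x₀) (extChartAt (𝓡 N) x₀ x) := by
  have h := extDeriv_formInChart_formPullback hξ (f := fun x : X => x) contMDiff_id (x₀ := x₀)
    (y₀ := x) (x := x) hx (mem_chart_source _ x)
  rw [formPullback_id, fderiv_mapInCharts (f := fun x : X => x) hx (mem_chart_source _ x)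
    mdifferentiableAt_id] at h
  rw [h, formInChart_extChartAt _ _ hx]
  have : mfderiv (𝓡 N) (𝓡 N) (fun x : X => x) x = ContinuousLinearMap.id ℝ _ := mfderiv_id
  rw [this]
  rfl

/-- The differential commutes with pullbacks. -/
theorem formPullback_formD {k : ℕ} {ξ : DForm N' Y k} (hξ : IsSmoothForm ξ) {f : X → Y}
    (hf : ContMDiff (𝓡 N) (𝓡 N') ∞ f) :
    formPullback (N := N) f (formD ξ) = formD (formPullback f ξ) := by
  funext x
  have h := extDeriv_formInChart_formPullback hξ hf (x₀ := x) (y₀ := f x) (mem_chart_source _ x)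
    (mem_chart_source _ (f x))
  rw [fderiv_mapInCharts (mem_chart_source _ x) (mem_chart_source _ (f x))
    (hf.mdifferentiableAt (by simp))] at h
  rw [formD, h]
  ext v
  refine congrArg (extDeriv (formInChart ξ (f x)) (extChartAt (𝓡 N') (f x) (f x)))
    (funext fun i => ?_)
  exact congrArg (fun w : EuclideanSpace ℝ (Fin N) =>
    (mfderiv (𝓡 N') 𝓘(ℝ, EuclideanSpace ℝ (Fin N')) (extChartAt (𝓡 N') (f x)) (f x) :
        EuclideanSpace ℝ (Fin N') →L[ℝ] EuclideanSpace ℝ (Fin N'))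
      ((mfderiv (𝓡 N) (𝓡 N') f x : EuclideanSpace ℝ (Fin N) →L[ℝ] EuclideanSpace ℝ (Fin N')) w))
    (mfderiv_symm_comp_mfderiv_extChartAt x (mem_chart_source _ x) (v i)).symm

theorem IsSmoothForm.differential {k : ℕ} {ξ : DForm N X k} (hξ : IsSmoothForm ξ) :
    IsSmoothForm (formD ξ) := by
  refine isSmoothForm_iff.2 fun x => ?_
  have h1 : ContDiffAt ℝ ∞ (extDeriv (formInChart ξ x)) (extChartAt (𝓡 N) x x) :=
    isBoundedLinearMap_alternatizeUncurryFin.contDiff.contDiffAt.comp (extChartAt (𝓡 N) x x)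
      ((isSmoothForm_iff.1 hξ x).fderiv_right (m := ∞) (by simp))
  refine h1.congr_of_eventuallyEq ?_
  filter_upwards [extChartAt_target_mem_nhds (I := 𝓡 N) x] with u hu
  have hx := (extChartAt (𝓡 N) x).map_target hu
  have := formInChart_formD hξ (x₀ := x) (x := (extChartAt (𝓡 N) x).symm u) (by simpa using hx)
  rwa [(extChartAt (𝓡 N) x).right_inv hu] at this

end SmoothPullback

/-! ### Differentiation in a parameter -/

/-- Symmetry of the mixed second derivatives in a parameter and in space. -/
theorem hasDerivAt_fderiv_of_contDiffAt {E G : Type*} [NormedAddCommGroup E] [NormedSpace ℝ E]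
    [NormedAddCommGroup G] [NormedSpace ℝ G] {Φ : ℝ × E → G} {s : ℝ} {u : E}
    (hΦ : ContDiffAt ℝ ∞ Φ (s, u)) :
    HasDerivAt (fun t => fderiv ℝ (fun y => Φ (t, y)) u)
      (fderiv ℝ (fun y => deriv (fun t => Φ (t, y)) s) u) s := by
  have hev : ∀ᶠ q in 𝓝 (s, u), DifferentiableAt ℝ Φ q := by
    filter_upwards [(hΦ.of_le (m := 1) (by simp)).eventually (by simp)] with q hq using
      hq.differentiableAt (by simp)
  have hd : DifferentiableAt ℝ (fderiv ℝ Φ) (s, u) :=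
    (hΦ.fderiv_right (m := ∞) (by simp)).differentiableAt (by simp)
  have hs : (fun t => fderiv ℝ (fun y => Φ (t, y)) u) =ᶠ[𝓝 s]
      fun t => fderiv ℝ Φ (t, u) ∘L ContinuousLinearMap.inr ℝ ℝ E := by
    have h0 : ContinuousAt (fun t : ℝ => (t, u)) s := continuousAt_id.prodMk continuousAt_const
    filter_upwards [h0.eventually hev] with t ht
    exact (ht.hasFDerivAt.comp u (hasFDerivAt_prodMk_right t u)).fderiv
  have hu : (fun y => deriv (fun t => Φ (t, y)) s) =ᶠ[𝓝 u] fun y => fderiv ℝ Φ (s, y) (1, 0) := by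
    have h0 : ContinuousAt (fun y : E => (s, y)) u := continuousAt_const.prodMk continuousAt_id
    filter_upwards [h0.eventually hev] with y hy
    have := (hy.hasFDerivAt.comp s (hasFDerivAt_prodMk_left s y)).hasDerivAt.deriv
    simpa [Function.comp_def] using this
  have hu' : fderiv ℝ (fun y => deriv (fun t => Φ (t, y)) s) u =
      fderiv ℝ (fderiv ℝ Φ) (s, u) (1, 0) ∘L ContinuousLinearMap.inr ℝ ℝ E := by
    rw [hu.fderiv_eq]
    have h1 : HasFDerivAt (fun y => fderiv ℝ Φ (s, y))
        (fderiv ℝ (fderiv ℝ Φ) (s, u) ∘L ContinuousLinearMap.inr ℝ ℝ E) u :=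
      hd.hasFDerivAt.comp u (hasFDerivAt_prodMk_right s u)
    have h2 := (h1.clm_apply (hasFDerivAt_const ((1 : ℝ), (0 : E)) u)).fderiv
    ext1 v
    have h3 := (hΦ.isSymmSndFDerivAt (by simpa using two_le_infty)) (0, v) (1, 0)
    rw [h2]
    simpa using h3
  rw [hu']
  refine HasDerivAt.congr_of_eventuallyEq ?_ hs
  have h1 : HasDerivAt (fun t => fderiv ℝ Φ (t, u)) (fderiv ℝ (fderiv ℝ Φ) (s, u) (1, 0)) s := by
    simpa [Function.comp_def] using
      (HasFDerivAt.comp (g := fderiv ℝ Φ) s hd.hasFDerivAt (hasFDerivAt_prodMk_left s u)).hasDerivAt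
  exact ((ContinuousLinearMap.compL ℝ E (ℝ × E) G).flip
    (ContinuousLinearMap.inr ℝ ℝ E)).hasFDerivAt.comp_hasDerivAt s h1

theorem IsBoundedLinearMap.hasDerivAt_comp {G G' : Type*} [NormedAddCommGroup G] [NormedSpace ℝ G]
    [NormedAddCommGroup G'] [NormedSpace ℝ G'] {A : G → G'} (hA : IsBoundedLinearMap ℝ A)
    {F : ℝ → G} {F' : G} {s : ℝ} (hF : HasDerivAt F F' s) :
    HasDerivAt (fun t => A (F t)) (A F') s :=
  hA.hasFDerivAt.comp_hasDerivAt s hF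

theorem HasDerivAt.alternatizeUncurryFin {E : Type*} [NormedAddCommGroup E] [NormedSpace ℝ E]
    {k : ℕ} {F : ℝ → E →L[ℝ] E [⋀^Fin k]→L[ℝ] ℝ} {F' : E →L[ℝ] E [⋀^Fin k]→L[ℝ] ℝ} {s : ℝ}
    (hF : HasDerivAt F F' s) :
    HasDerivAt (fun t => ContinuousAlternatingMap.alternatizeUncurryFin (F t))
      (ContinuousAlternatingMap.alternatizeUncurryFin F') s :=
  isBoundedLinearMap_alternatizeUncurryFin.hasDerivAt_comp hF

/-- Differentiation in a parameter commutes with the exterior derivative. -/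
theorem deriv_extDeriv {E : Type*} [NormedAddCommGroup E] [NormedSpace ℝ E] {k : ℕ}
    {Φ : ℝ × E → E [⋀^Fin k]→L[ℝ] ℝ} {s : ℝ} {u : E} (hΦ : ContDiffAt ℝ ∞ Φ (s, u)) :
    deriv (fun t => extDeriv (fun y => Φ (t, y)) u) s =
      extDeriv (fun y => deriv (fun t => Φ (t, y)) s) u := by
  have h := (hasDerivAt_fderiv_of_contDiffAt hΦ).alternatizeUncurryFin
  exact h.deriv

/-! ### Forms in the chart at a point -/

section ChartAtBasePoint

variable {N : ℕ} {X : Type*} [TopologicalSpace X] [ChartedSpace (EuclideanSpace ℝ (Fin N)) X]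
  [IsManifold (𝓡 N) ∞ X]

theorem mfderiv_extChartAt_base (x : X) :
    (mfderiv (𝓡 N) 𝓘(ℝ, EuclideanSpace ℝ (Fin N)) (extChartAt (𝓡 N) x) x :
      EuclideanSpace ℝ (Fin N) →L[ℝ] EuclideanSpace ℝ (Fin N)) = ContinuousLinearMap.id ℝ _ := by
  have := isManifold_one (N := N) (X := X)
  exact mfderiv_extChartAt_self

theorem formInChart_base {k : ℕ} (ξ : DForm N X k) (x : X) :
    formInChart ξ x (extChartAt (𝓡 N) x x) = ξ x := by
  rw [formInChart_extChartAt _ _ (mem_chart_source _ x)]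
  ext v
  have h : ∀ w, (mfderiv 𝓘(ℝ, EuclideanSpace ℝ (Fin N)) (𝓡 N) (extChartAt (𝓡 N) x).symm
      (extChartAt (𝓡 N) x x) : EuclideanSpace ℝ (Fin N) →L[ℝ] EuclideanSpace ℝ (Fin N)) w = w := by
    intro w
    have := mfderiv_symm_comp_mfderiv_extChartAt x (mem_chart_source _ x) w
    rwa [mfderiv_extChartAt_base] at this
  exact congrArg (ξ x : EuclideanSpace ℝ (Fin N) [⋀^Fin k]→L[ℝ] ℝ) (funext fun i => h (v i))

/-- In the chart at `x` the tangent space at `x` is the model space, so that the chart derivative in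
`formD` drops out. -/
theorem formD_eq {k : ℕ} (ξ : DForm N X k) (x : X) :
    (formD ξ x : EuclideanSpace ℝ (Fin N) [⋀^Fin (k + 1)]→L[ℝ] ℝ) =
      extDeriv (formInChart ξ x) (extChartAt (𝓡 N) x x) := by
  ext v
  exact congrArg (extDeriv (formInChart ξ x) (extChartAt (𝓡 N) x x)) (funext fun i =>
    congrArg (fun A : EuclideanSpace ℝ (Fin N) →L[ℝ] EuclideanSpace ℝ (Fin N) => A (v i))
      (mfderiv_extChartAt_base x))

theorem formD_smul {k : ℕ} (c : ℝ) (ξ : DForm N X k) : formD (c • ξ) = c • formD ξ := by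
  funext x
  have h : formInChart (c • ξ) x = c • formInChart ξ x := rfl
  refine (formD_eq (c • ξ) x).trans ?_
  rw [h, extDeriv_smul]
  exact congrArg (c • ·) (formD_eq ξ x).symm

theorem IsSmoothForm.add {k : ℕ} {ξ η : DForm N X k} (hξ : IsSmoothForm ξ) (hη : IsSmoothForm η) :
    IsSmoothForm (ξ + η) :=
  isSmoothForm_iff.2 fun x => (isSmoothForm_iff.1 hξ x).add (isSmoothForm_iff.1 hη x)

theorem IsSmoothForm.const_smul {k : ℕ} (c : ℝ) {ξ : DForm N X k} (hξ : IsSmoothForm ξ) :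
    IsSmoothForm (c • ξ) :=
  isSmoothForm_iff.2 fun x => (isSmoothForm_iff.1 hξ x).const_smul c

theorem isSmoothForm_zero {k : ℕ} : IsSmoothForm (0 : DForm N X k) :=
  isSmoothForm_iff.2 fun _ => contDiffAt_const (c := 0)

end ChartAtBasePoint

/-! ### Derivatives of paths of forms -/

section BoundedMaps

variable {E E' : Type*} [NormedAddCommGroup E] [NormedSpace ℝ E] [NormedAddCommGroup E']
  [NormedSpace ℝ E'] {k : ℕ}

theorem HasDerivAt.form_comp {F : ℝ → E [⋀^Fin k]→L[ℝ] ℝ} {F' : E [⋀^Fin k]→L[ℝ] ℝ} {s : ℝ}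
    (hF : HasDerivAt F F' s) (A : E' →L[ℝ] E) :
    HasDerivAt (fun t => (F t).compContinuousLinearMap A) (F'.compContinuousLinearMap A) s := by
  have : IsBoundedLinearMap ℝ fun α : E [⋀^Fin k]→L[ℝ] ℝ => α.compContinuousLinearMap A :=
    { map_add := fun _ _ => rfl
      map_smul := fun _ _ => rfl
      bound := ⟨‖A‖ ^ k + 1, by positivity, fun α => by
        have := α.norm_compContinuousLinearMap_le A
        rw [Fintype.card_fin] at this
        nlinarith [norm_nonneg α]⟩ }
  exact this.hasDerivAt_comp hF

theorem HasDerivAt.form_apply {F : ℝ → E [⋀^Fin k]→L[ℝ] ℝ} {F' : E [⋀^Fin k]→L[ℝ] ℝ} {s : ℝ}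
    (hF : HasDerivAt F F' s) (v : Fin k → E) : HasDerivAt (fun t => F t v) (F' v) s := by
  have : IsBoundedLinearMap ℝ fun α : E [⋀^Fin k]→L[ℝ] ℝ => α v :=
    { map_add := fun _ _ => rfl
      map_smul := fun _ _ => rfl
      bound := (ContinuousAlternatingMap.apply ℝ E ℝ v).isBoundedLinearMap.bound }
  exact this.hasDerivAt_comp hF

theorem hasDerivAt_hodgeDualForm {ι : Type*} [Fintype ι] {m N : ℕ} (h : k + m = N) (e f : ι → E)
    (μ : E [⋀^Fin N]→L[ℝ] ℝ) {F : ℝ → E [⋀^Fin k]→L[ℝ] ℝ} {F' : E [⋀^Fin k]→L[ℝ] ℝ} {s : ℝ}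
    (hF : HasDerivAt F F' s) :
    HasDerivAt (fun t => hodgeDualForm h e f μ (F t)) (hodgeDualForm h e f μ F') s := by
  unfold hodgeDualForm
  refine HasDerivAt.fun_const_smul (F := E [⋀^Fin m]→L[ℝ] ℝ) _
    (HasDerivAt.fun_sum (F := E [⋀^Fin m]→L[ℝ] ℝ) fun i _ =>
      HasDerivAt.smul_const (F := E [⋀^Fin m]→L[ℝ] ℝ) ?_ _)
  exact hF.form_apply fun s => f (i s)

end BoundedMaps

/-! ### The Euler flow and the Lie derivative -/

section Euler

theorem eulerFlow_zero {P : Type*} [MulAction ℝˣ P] (p : P) : eulerFlow 0 p = p := by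
  have : Units.mk0 (Real.exp 0) (Real.exp_ne_zero 0) = 1 := by ext; simp
  rw [eulerFlow, this, one_smul]

theorem eulerFlow_add {P : Type*} [MulAction ℝˣ P] (s t : ℝ) (p : P) :
    eulerFlow (s + t) p = eulerFlow s (eulerFlow t p) := by
  rw [eulerFlow, eulerFlow, eulerFlow, smul_smul]
  congr 1
  ext
  simp [Real.exp_add]

variable {n : ℕ}
  {M : Type*} [TopologicalSpace M] [ChartedSpace (EuclideanSpace ℝ (Fin n)) M]
  {P : Type*} [TopologicalSpace P] [ChartedSpace (EuclideanSpace ℝ (Fin (n + 1))) P]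
  [MulAction ℝˣ P]

theorem IsPrincipalRxBundle.contMDiff_eulerFlow {pr : P → M} (hpr : IsPrincipalRxBundle n pr) :
    ContMDiff (𝓘(ℝ, ℝ).prod (𝓡 (n + 1))) (𝓡 (n + 1)) ∞
      (Function.uncurry (eulerFlow (P := P))) := by
  have h1 : ContMDiff 𝓘(ℝ, ℝ) 𝓘(ℝ, ℝ) ∞
      (fun s : ℝ => Units.mk0 (Real.exp s) (Real.exp_ne_zero s)) :=
    ContMDiff.of_comp_isOpenEmbedding Units.isOpenEmbedding_val Real.contDiff_exp.contMDiff
  exact hpr.smooth_smul.comp ((h1.comp contMDiff_fst).prodMk contMDiff_snd)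

theorem IsPrincipalRxBundle.contMDiff_eulerFlow_right {pr : P → M} (hpr : IsPrincipalRxBundle n pr)
    (s : ℝ) : ContMDiff (𝓡 (n + 1)) (𝓡 (n + 1)) ∞ (eulerFlow (P := P) s) :=
  hpr.contMDiff_eulerFlow.comp (contMDiff_const.prodMk contMDiff_id)

theorem IsPrincipalRxBundle.mdifferentiable_eulerFlow {pr : P → M} (hpr : IsPrincipalRxBundle n pr)
    (s : ℝ) : MDifferentiable (𝓡 (n + 1)) (𝓡 (n + 1)) (eulerFlow (P := P) s) :=
  (hpr.contMDiff_eulerFlow_right s).mdifferentiable (by simp)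

variable [IsManifold (𝓡 (n + 1)) ∞ P]

theorem IsSmoothForm.contDiffAt_formInChart_eulerFlow {pr : P → M} (hpr : IsPrincipalRxBundle n pr)
    {k : ℕ} {ξ : DForm (n + 1) P k} (hξ : IsSmoothForm ξ) (p : P) :
    ContDiffAt ℝ ∞ (fun q : ℝ × EuclideanSpace ℝ (Fin (n + 1)) =>
      formInChart (formPullback (eulerFlow q.1) ξ) p q.2) (0, extChartAt (𝓡 (n + 1)) p p) :=
  contDiffAt_formInChart_formPullback (y₀ := eulerFlow 0 p) hpr.contMDiff_eulerFlow
    (mem_chart_source _ p) (mem_chart_source _ _) (isSmoothForm_iff.1 hξ _)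

/-- The derivative that defines the Lie derivative of a smooth form exists. -/
theorem IsSmoothForm.hasDerivAt_lieEuler {pr : P → M} (hpr : IsPrincipalRxBundle n pr)
    {k : ℕ} {ξ : DForm (n + 1) P k} (hξ : IsSmoothForm ξ) (p : P) :
    HasDerivAt (F := EuclideanSpace ℝ (Fin (n + 1)) [⋀^Fin k]→L[ℝ] ℝ)
      (fun s : ℝ => formPullback (eulerFlow s) ξ p) (lieEuler ξ p) 0 := by
  have h1 := (hξ.contDiffAt_formInChart_eulerFlow hpr p).comp
    (f := fun s : ℝ => (s, extChartAt (𝓡 (n + 1)) p p)) 0 (contDiffAt_id.prodMk contDiffAt_const)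
  have h2 := (h1.differentiableAt (by simp)).hasDerivAt
  simp only [Function.comp_def, formInChart_base] at h2
  exact h2

theorem formInChart_lieEuler {pr : P → M} (hpr : IsPrincipalRxBundle n pr)
    {k : ℕ} {ξ : DForm (n + 1) P k} (hξ : IsSmoothForm ξ) (p : P)
    (u : EuclideanSpace ℝ (Fin (n + 1))) :
    formInChart (lieEuler ξ) p u =
      deriv (fun s : ℝ => formInChart (formPullback (eulerFlow s) ξ) p u) 0 := by
  have h := HasDerivAt.form_comp (E := EuclideanSpace ℝ (Fin (n + 1)))
    (E' := EuclideanSpace ℝ (Fin (n + 1)))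
    (hξ.hasDerivAt_lieEuler hpr ((extChartAt (𝓡 (n + 1)) p).symm u))
    (mfderiv 𝓘(ℝ, EuclideanSpace ℝ (Fin (n + 1))) (𝓡 (n + 1)) (extChartAt (𝓡 (n + 1)) p).symm u)
  exact h.deriv.symm

/-- The Lie derivative commutes with the differential: pullback along the flow does, and so does
differentiation in the flow parameter. -/
theorem lieEuler_formD {pr : P → M} (hpr : IsPrincipalRxBundle n pr)
    {k : ℕ} {ξ : DForm (n + 1) P k} (hξ : IsSmoothForm ξ) :
    lieEuler (formD ξ) = formD (lieEuler ξ) := by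
  funext p
  have h1 : (fun s : ℝ => (formPullback (eulerFlow s) (formD ξ) p :
      EuclideanSpace ℝ (Fin (n + 1)) [⋀^Fin (k + 1)]→L[ℝ] ℝ)) = fun s =>
      extDeriv (fun u => formInChart (formPullback (eulerFlow s) ξ) p u)
        (extChartAt (𝓡 (n + 1)) p p) := by
    funext s
    rw [formPullback_formD hξ (hpr.contMDiff_eulerFlow_right s)]
    exact formD_eq _ p
  refine Eq.trans ?_ (formD_eq (lieEuler ξ) p).symm
  have h2 := deriv_extDeriv (hξ.contDiffAt_formInChart_eulerFlow hpr p)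
  have h3 : formInChart (lieEuler ξ) p = fun u =>
      deriv (fun s : ℝ => formInChart (formPullback (eulerFlow s) ξ) p u) 0 :=
    funext fun u => formInChart_lieEuler hpr hξ p u
  rw [h3, ← h2, ← h1]
  rfl

theorem lieEuler_add {pr : P → M} (hpr : IsPrincipalRxBundle n pr) {k : ℕ}
    {ξ η : DForm (n + 1) P k} (hξ : IsSmoothForm ξ) (hη : IsSmoothForm η) :
    lieEuler (ξ + η) = lieEuler ξ + lieEuler η :=
  funext fun p => (HasDerivAt.fun_add (F := EuclideanSpace ℝ (Fin (n + 1)) [⋀^Fin k]→L[ℝ] ℝ)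
    (hξ.hasDerivAt_lieEuler hpr p) (hη.hasDerivAt_lieEuler hpr p)).deriv

theorem lieEuler_smul {pr : P → M} (hpr : IsPrincipalRxBundle n pr) {k : ℕ} (c : ℝ)
    {ξ : DForm (n + 1) P k} (hξ : IsSmoothForm ξ) : lieEuler (c • ξ) = c • lieEuler ξ :=
  funext fun p => (HasDerivAt.fun_const_smul
    (F := EuclideanSpace ℝ (Fin (n + 1)) [⋀^Fin k]→L[ℝ] ℝ) c (hξ.hasDerivAt_lieEuler hpr p)).deriv

end Euler

/-! ### Linear algebra of a Carrollian metric at a point -/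

section AdaptedBasis

/-- A degenerate metric with kernel `ker L = ℝ x` and a functional `θ` with `θ x = 1` have a common
adapted basis, beginning with `x` and orthonormal for the Lorentzian metric `g - θ ⊗ θ`. -/
theorem exists_adapted_basis {n : ℕ} {V W : Type*} [AddCommGroup V] [Module ℝ V]
    [FiniteDimensional ℝ V] [AddCommGroup W] [Module ℝ W] [FiniteDimensional ℝ W]
    (hV : Module.finrank ℝ V = n + 1) (hW : Module.finrank ℝ W = n)
    (g : LinearMap.BilinForm ℝ V) (hsymm : ∀ u v, g u v = g v u) (hnonneg : ∀ u, 0 ≤ g u u)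
    (L : V →ₗ[ℝ] W) (hL : Function.Surjective L) (hker : ∀ u, (∀ v, g u v = 0) ↔ L u = 0)
    (θ : V →ₗ[ℝ] ℝ) {x : V} (hθ : θ x = 1) (hx : L x = 0) :
    ∃ e : Module.Basis (Fin (n + 1)) ℝ V, e 0 = x ∧ (∀ i, θ (e i) = if i = 0 then 1 else 0) ∧
      (∀ i j, g (e i) (e j) - θ (e i) * θ (e j) =
        if i = j then (if i = 0 then -1 else 1) else 0) ∧
      LinearIndependent ℝ fun i : Fin n => L (e i.succ) := by
  have hx0 : x ≠ 0 := by
    rintro rfl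
    simp at hθ
  have hspan : ∀ u, L u = 0 → ∃ c : ℝ, c • x = u := by
    have h1 : Module.finrank ℝ (LinearMap.ker L) = 1 := by
      have := L.finrank_range_add_finrank_ker
      rw [LinearMap.range_eq_top.2 hL, finrank_top, hV, hW] at this
      omega
    intro u hu
    obtain ⟨c, hc⟩ := (finrank_eq_one_iff_of_nonzero' (⟨x, hx⟩ : LinearMap.ker L)
      (fun h => hx0 (congrArg Subtype.val h))).1 h1 ⟨u, hu⟩
    exact ⟨c, congrArg Subtype.val hc⟩
  have hgx : ∀ v, g x v = 0 := (hker x).2 hx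
  -- Replacing `-θ ⊗ θ` by `+θ ⊗ θ` gives a positive definite form `H` with the same adapted bases.
  let H : LinearMap.BilinForm ℝ V := g + (LinearMap.mul ℝ ℝ).compl₁₂ θ θ
  have hH : ∀ u v, H u v = g u v + θ u * θ v := fun _ _ => rfl
  have hdef : ∀ u, H u u = 0 → u = 0 := by
    intro u hu
    rw [hH] at hu
    have h1 : g u u = 0 := by nlinarith [hnonneg u, mul_self_nonneg (θ u)]
    have h2 : θ u = 0 := by
      rw [h1, zero_add] at hu
      exact mul_self_eq_zero.1 hu
    -- A null vector `u` of a positive semidefinite form lies in its kernel: otherwise the form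
    -- takes the value `-1` at `v + t • u`, where `t` solves `g v v + 2 * t * g u v = -1`.
    have h3 : ∀ v, g u v = 0 := by
      intro v
      by_contra hne
      have h4 := hnonneg (v + (-(g v v + 1) / (2 * g u v)) • u)
      simp only [map_add, map_smul, LinearMap.add_apply, LinearMap.smul_apply, smul_eq_mul, h1,
        hsymm v u] at h4
      have h5 : -(g v v + 1) / (2 * g u v) * g u v = -(g v v + 1) / 2 := by
        field_simp
      linarith
    obtain ⟨c, rfl⟩ := hspan u ((hker u).1 h3)
    rw [map_smul, hθ, smul_eq_mul, mul_one] at h2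
    rw [h2, zero_smul]
  obtain ⟨e, he0, he⟩ := H.exists_orthonormal_basis_extending hV
    (fun u v => by rw [hH, hH, hsymm, mul_comm])
    (fun u => by rw [hH]; exact add_nonneg (hnonneg u) (mul_self_nonneg _)) hdef (x := x)
    (by rw [hH, hgx, hθ]; norm_num)
  have hθe : ∀ i, θ (e i) = if i = 0 then 1 else 0 := by
    intro i
    have := he 0 i
    rw [he0, hH, hgx, hθ, zero_add, one_mul] at this
    simpa [eq_comm] using this
  refine ⟨e, he0, hθe, fun i j => ?_, ?_⟩
  · have h1 := he i j
    rw [hH] at h1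
    rw [eq_sub_of_add_eq h1, hθe, hθe]
    by_cases hij : i = j
    · subst hij
      by_cases hi : i = 0
      · simp [hi]
      · simp [hi]
    · by_cases hi : i = 0
      · subst hi
        simp [hij, Ne.symm hij]
      · simp [hij, hi]
  · rw [Fintype.linearIndependent_iff]
    intro c hc j
    have h1 : L (∑ i, c i • e (Fin.succ i)) = 0 := by simpa using hc
    have h2 := (hker _).2 h1 (e (Fin.succ j))
    have h3 : ∀ i, g (e (Fin.succ i)) (e (Fin.succ j)) = if i = j then 1 else 0 := by
      intro i
      have := he (Fin.succ i) (Fin.succ j)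
      rw [hH, hθe] at this
      simpa using this
    simpa [h3] using h2

variable {V : Type*} [AddCommGroup V] [Module ℝ V] {n : ℕ}

theorem dual_frame_of_lorentz_orthonormal {B : LinearMap.BilinForm ℝ V} {e : Fin (n + 1) → V}
    (he : ∀ i j, B (e i) (e j) = if i = j then (if i = 0 then -1 else 1) else 0)
    (i j : Fin (n + 1)) :
    B ((if i = 0 then (-1 : ℝ) else 1) • e i) (e j) = if i = j then 1 else 0 := by
  rw [map_smul, LinearMap.smul_apply, he]
  by_cases hij : i = j
  · subst hij
    by_cases hi : i = 0 <;> simp [hi]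
  · simp [hij]

variable [TopologicalSpace V]

/-- A nonzero form without components along the timelike direction has positive norm. -/
theorem formInner_self_pos (b : Module.Basis (Fin (n + 1)) ℝ V) (B : LinearMap.BilinForm ℝ V)
    {e : Fin (n + 1) → V}
    (he : ∀ i j, B (e i) (e j) = if i = j then (if i = 0 then -1 else 1) else 0)
    (α : V [⋀^Fin n]→L[ℝ] ℝ) (hα : ∀ v : Fin n → V, (∃ i, v i = e 0) → α v = 0)
    (hα' : α (fun i => e i.succ) ≠ 0) : 0 < formInner b (fun u v => B u v) α α := by
  rw [formInner_eq_of_dual_frame b B (dual_frame_of_lorentz_orthonormal he)]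
  have hterm : ∀ i : Fin n → Fin (n + 1), α (fun s => e (i s)) *
      α (fun s => (if i s = 0 then (-1 : ℝ) else 1) • e (i s)) =
      α (fun s => e (i s)) * α (fun s => e (i s)) := by
    intro i
    by_cases hi : ∃ s, i s = 0
    · obtain ⟨s, hs⟩ := hi
      rw [hα (fun s => e (i s)) ⟨s, congrArg e hs⟩, zero_mul, zero_mul]
    · push Not at hi
      simp [hi]
  simp only [hterm]
  refine mul_pos (by positivity) (Finset.sum_pos' (fun i _ => mul_self_nonneg _)
    ⟨Fin.succ, Finset.mem_univ _, mul_self_pos.2 hα'⟩)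

theorem wedge_one_form_ne_zero (θ : V [⋀^Fin 1]→L[ℝ] ℝ) (α : V [⋀^Fin n]→L[ℝ] ℝ)
    {e : Fin (n + 1) → V} (hθ : θ ![e 0] ≠ 0)
    (hα : ∀ v : Fin n → V, (∃ i, v i = e 0) → α v = 0) (hα' : α (fun i => e i.succ) ≠ 0) :
    wedge (Nat.add_comm 1 n) θ α ≠ 0 := by
  intro h0
  have h1 := wedge_apply_of_shuffle (Nat.add_comm 1 n) θ α
    (Sum.elim (fun _ => e 0) fun i => e i.succ) (by
      intro σ hσ
      have h1 : ¬ Set.MapsTo σ (Set.range Sum.inr) (Set.range Sum.inr) := fun hc =>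
        hσ (Equiv.Perm.mem_sumCongrHom_range_of_perm_mapsTo_inl
          ((Equiv.Perm.perm_mapsTo_inl_iff_mapsTo_inr σ).2 hc))
      simp only [Set.MapsTo, Set.mem_range, not_forall] at h1
      obtain ⟨_, ⟨j, rfl⟩, hj⟩ := h1
      rcases hσj : σ (Sum.inr j) with i | i
      · exact mul_eq_zero_of_right _ (hα _ ⟨j, by simp [hσj]⟩)
      · exact absurd ⟨i, hσj.symm⟩ hj)
  rw [h0] at h1
  have h2 : (fun _ : Fin 1 => e 0) = ![e 0] := by ext i; simp
  simp only [Sum.elim_inl, Sum.elim_inr, h2] at h1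
  exact mul_ne_zero hθ hα' h1.symm

end AdaptedBasis

/-! ### The Lorentzian metric, the volume form and the Hodge dual at a point -/

theorem ContinuousAlternatingMap.apply_ne_zero_of_linearIndependent {V : Type*} [AddCommGroup V]
    [Module ℝ V] [TopologicalSpace V] [FiniteDimensional ℝ V] {n : ℕ}
    (hn : n = Module.finrank ℝ V) {α : V [⋀^Fin n]→L[ℝ] ℝ} (hα : α ≠ 0) {w : Fin n → V}
    (hw : LinearIndependent ℝ w) : α w ≠ 0 := by
  let b := basisOfLinearIndependentOfCardEqFinrank' _ hw (by simpa using hn)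
  have hne : α.toAlternatingMap ≠ 0 :=
    fun h => hα (ContinuousAlternatingMap.toAlternatingMap_injective h)
  have h1 := (AlternatingMap.map_basis_ne_zero_iff b _).2 hne
  rw [coe_basisOfLinearIndependentOfCardEqFinrank'] at h1
  exact h1

section CarrollPointwise

variable {n : ℕ}
  {M : Type*} [TopologicalSpace M] [ChartedSpace (EuclideanSpace ℝ (Fin n)) M]
  {P : Type*} [TopologicalSpace P] [ChartedSpace (EuclideanSpace ℝ (Fin (n + 1))) P]

section Bundle

variable [MulAction ℝˣ P] {pr : P → M}

/-- The projection is a submersion, because it has smooth local sections. -/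
theorem IsPrincipalRxBundle.surjective_mfderiv_proj (hpr : IsPrincipalRxBundle n pr) (p : P) :
    Function.Surjective (mfderiv (𝓡 (n + 1)) (𝓡 n) pr p :
      EuclideanSpace ℝ (Fin (n + 1)) →L[ℝ] EuclideanSpace ℝ (Fin n)) := by
  obtain ⟨U, e, hU, hxU, hsrc, htgt, -, he', hproj, -⟩ := hpr.locally_trivial (pr p)
  have hp : p ∈ e.source := by rw [hsrc]; exact hxU
  have hep : e p = (pr p, (e p).2) := Prod.ext (hproj p hp) rfl
  -- a local section of the bundle through `p`
  let σ : M → P := fun x => e.symm (x, (e p).2)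
  have hσp : σ (pr p) = p := by
    change e.symm (pr p, (e p).2) = p
    rw [← hep, e.left_inv hp]
  have hmem : ∀ x ∈ U, (x, (e p).2) ∈ e.target := fun x hx => by
    rw [htgt]; exact ⟨hx, Set.mem_univ _⟩
  have hσ : MDifferentiableAt (𝓡 n) (𝓡 (n + 1)) σ (pr p) := by
    have h1 : ContMDiffAt (𝓡 n) ((𝓡 n).prod 𝓘(ℝ, ℝ)) ∞ (fun x : M => (x, (e p).2)) (pr p) :=
      contMDiffAt_id.prodMk contMDiffAt_const
    have h2 := he'.contMDiffAt (e.open_target.mem_nhds (hmem (pr p) hxU))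
    exact (ContMDiffAt.comp (pr p) h2 h1).mdifferentiableAt (by simp)
  have hcomp : (fun x => pr (σ x)) =ᶠ[𝓝 (pr p)] id := by
    filter_upwards [hU.mem_nhds hxU] with x hx
    change pr (e.symm (x, (e p).2)) = x
    rw [← hproj _ (e.map_target (hmem x hx)), e.right_inv (hmem x hx)]
  have hd : HasMFDerivAt (𝓡 (n + 1)) (𝓡 n) pr (σ (pr p)) (mfderiv (𝓡 (n + 1)) (𝓡 n) pr p :
      EuclideanSpace ℝ (Fin (n + 1)) →L[ℝ] EuclideanSpace ℝ (Fin n)) := by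
    rw [hσp]
    exact (hpr.smooth_proj.mdifferentiableAt (by simp)).hasMFDerivAt
  have h3 := HasMFDerivAt.comp (pr p) hd hσ.hasMFDerivAt
  have h4 := (hasMFDerivAt_id (I := 𝓡 n) (pr p)).congr_of_eventuallyEq hcomp
  have h5 := hasMFDerivAt_unique h3 h4
  intro w
  exact ⟨(mfderiv (𝓡 n) (𝓡 (n + 1)) σ (pr p) :
    EuclideanSpace ℝ (Fin n) →L[ℝ] EuclideanSpace ℝ (Fin (n + 1))) w,
    congrArg (fun A : EuclideanSpace ℝ (Fin n) →L[ℝ] EuclideanSpace ℝ (Fin n) => A w) h5⟩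

theorem IsPrincipalRxBundle.mfderiv_proj_eulerField [IsManifold (𝓡 (n + 1)) ∞ P]
    (hpr : IsPrincipalRxBundle n pr) (p : P) :
    (mfderiv (𝓡 (n + 1)) (𝓡 n) pr p :
      EuclideanSpace ℝ (Fin (n + 1)) →L[ℝ] EuclideanSpace ℝ (Fin n)) (eulerField n p) = 0 := by
  have h1 : MDifferentiableAt 𝓘(ℝ, ℝ) (𝓡 (n + 1)) (fun s : ℝ => eulerFlow s p) 0 :=
    ((hpr.contMDiff_eulerFlow.comp (contMDiff_id.prodMk contMDiff_const)).mdifferentiable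
      (by simp)) 0
  have hd : HasMFDerivAt (𝓡 (n + 1)) (𝓡 n) pr (eulerFlow 0 p) (mfderiv (𝓡 (n + 1)) (𝓡 n) pr p :
      EuclideanSpace ℝ (Fin (n + 1)) →L[ℝ] EuclideanSpace ℝ (Fin n)) := by
    rw [eulerFlow_zero]
    exact (hpr.smooth_proj.mdifferentiableAt (by simp)).hasMFDerivAt
  have h2 := HasMFDerivAt.comp (0 : ℝ) hd h1.hasMFDerivAt
  have h3 : pr ∘ (fun s : ℝ => eulerFlow s p) = fun _ => pr p :=
    funext fun s => hpr.proj_smul _ p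
  rw [h3] at h2
  have h4 := hasMFDerivAt_unique h2 (hasMFDerivAt_const (pr p) (0 : ℝ))
  exact congrArg (fun A : ℝ →L[ℝ] EuclideanSpace ℝ (Fin n) => A 1) h4

end Bundle

variable [MulAction ℝˣ P] [IsManifold (𝓡 (n + 1)) ∞ P] {pr : P → M} (g : CarrollianMetric n pr)
  (Θ : RxConnection n P)

/-- The connection form as a field of linear functionals. -/
noncomputable def RxConnection.functional (p : P) : EuclideanSpace ℝ (Fin (n + 1)) →L[ℝ] ℝ :=
  (ContinuousAlternatingMap.ofSubsingleton ℝ (EuclideanSpace ℝ (Fin (n + 1))) ℝ (0 : Fin 1)).symm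
    (Θ.form p)

theorem RxConnection.functional_apply (p : P) (u : EuclideanSpace ℝ (Fin (n + 1))) :
    Θ.functional p u = Θ.form p ![u] := by
  have : (fun _ => u : Fin 1 → EuclideanSpace ℝ (Fin (n + 1))) = ![u] := by ext1 i; simp
  exact congrArg (Θ.form p : EuclideanSpace ℝ (Fin (n + 1)) [⋀^Fin 1]→L[ℝ] ℝ) this

/-- The Carrollian metric as a field of bilinear maps on the model space. -/
def CarrollianMetric.toCLM (p : P) : EuclideanSpace ℝ (Fin (n + 1)) →L[ℝ]
    EuclideanSpace ℝ (Fin (n + 1)) →L[ℝ] ℝ := g.val p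

/-- The Lorentzian metric as a field of bilinear forms. -/
noncomputable def lorentzBilin (p : P) :
    LinearMap.BilinForm ℝ (EuclideanSpace ℝ (Fin (n + 1))) :=
  LinearMap.mk₂ ℝ (fun u v => g.toCLM p u v - Θ.functional p u * Θ.functional p v)
    (fun u u' v => by simp only [map_add, add_apply]; ring)
    (fun c u v => by simp only [map_smul, smul_apply, smul_eq_mul]; ring)
    (fun u v v' => by simp only [map_add]; ring)
    (fun c u v => by simp only [map_smul, smul_eq_mul]; ring)

theorem lorentzBilin_eq_toCLM (p : P) (u v : EuclideanSpace ℝ (Fin (n + 1))) :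
    lorentzBilin g Θ p u v = g.toCLM p u v - Θ.functional p u * Θ.functional p v := rfl

theorem lorentzBilin_apply (p : P) (u v : EuclideanSpace ℝ (Fin (n + 1))) :
    lorentzBilin g Θ p u v = lorentzMetric g Θ p u v := by
  rw [lorentzBilin_eq_toCLM, Θ.functional_apply, Θ.functional_apply]
  rfl

/-- At each point there is a basis, orthonormal for `G`, that begins with the Euler field and whose
other vectors project to a basis of the tangent space of the base. -/
theorem exists_adapted_basis_at (hpr : IsPrincipalRxBundle n pr) (p : P) :
    ∃ e : Module.Basis (Fin (n + 1)) ℝ (EuclideanSpace ℝ (Fin (n + 1))),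
      e 0 = eulerField n p ∧
      (∀ i j, lorentzBilin g Θ p (e i) (e j) = if i = j then (if i = 0 then -1 else 1) else 0) ∧
      LinearIndependent ℝ fun i : Fin n => (mfderiv (𝓡 (n + 1)) (𝓡 n) pr p :
        EuclideanSpace ℝ (Fin (n + 1)) →L[ℝ] EuclideanSpace ℝ (Fin n)) (e i.succ) := by
  let L : EuclideanSpace ℝ (Fin (n + 1)) →L[ℝ] EuclideanSpace ℝ (Fin n) :=
    mfderiv (𝓡 (n + 1)) (𝓡 n) pr p
  let G : EuclideanSpace ℝ (Fin (n + 1)) →L[ℝ] EuclideanSpace ℝ (Fin (n + 1)) →L[ℝ] ℝ := g.val p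
  obtain ⟨e, h0, -, h1, h2⟩ := exists_adapted_basis (n := n) (by simp) (by simp)
    (LinearMap.mk₂ ℝ (fun u v => G u v) (by simp) (by simp) (by simp) (by simp))
    (g.symm p) (g.nonneg p) (L : EuclideanSpace ℝ (Fin (n + 1)) →ₗ[ℝ] EuclideanSpace ℝ (Fin n))
    (hpr.surjective_mfderiv_proj p) (g.ker p)
    (Θ.functional p : EuclideanSpace ℝ (Fin (n + 1)) →ₗ[ℝ] ℝ) (x := eulerField n p)
    ((Θ.functional_apply p _).trans (Θ.euler p)) (hpr.mfderiv_proj_eulerField p)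
  exact ⟨e, h0, h1, h2⟩

theorem exists_dual_frame_at (hpr : IsPrincipalRxBundle n pr) (p : P) :
    ∃ e f : Fin (n + 1) → EuclideanSpace ℝ (Fin (n + 1)),
      ∀ i j, lorentzBilin g Θ p (f i) (e j) = if i = j then 1 else 0 := by
  obtain ⟨e, -, he, -⟩ := exists_adapted_basis_at g Θ hpr p
  exact ⟨e, _, dual_frame_of_lorentz_orthonormal he⟩

theorem gInner_eq (p : P) {k : ℕ} (η ξ : EuclideanSpace ℝ (Fin (n + 1)) [⋀^Fin k]→L[ℝ] ℝ) :
    gInner g Θ p η ξ = formInner (V := EuclideanSpace ℝ (Fin (n + 1))) (tangentBasis (n + 1) p)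
      (fun u v => lorentzBilin g Θ p u v) η ξ := by
  simp only [lorentzBilin_apply]
  rfl

variable [IsManifold (𝓡 n) ∞ M] (o : OrientationForm n M)

theorem isHodgeDualAt_iff (p : P) {k m : ℕ} (h : k + m = n + 1)
    (ξ : EuclideanSpace ℝ (Fin (n + 1)) [⋀^Fin k]→L[ℝ] ℝ)
    (β : EuclideanSpace ℝ (Fin (n + 1)) [⋀^Fin m]→L[ℝ] ℝ) :
    IsHodgeDualAt g Θ o p h ξ β ↔ IsHodgeDualForm (V := EuclideanSpace ℝ (Fin (n + 1)))
      (tangentBasis (n + 1) p) (fun u v => lorentzBilin g Θ p u v) h (volTotal g Θ o p) ξ β := by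
  simp only [lorentzBilin_apply]
  rfl

/-- The pulled back orientation form is horizontal. -/
theorem formPullback_proj_eq_zero (hpr : IsPrincipalRxBundle n pr) (p : P)
    (v : Fin n → EuclideanSpace ℝ (Fin (n + 1))) (hv : ∃ i, v i = eulerField n p) :
    formPullback pr o.form p v = 0 := by
  obtain ⟨i, hi⟩ := hv
  refine (o.form (pr p)).map_coord_zero i ?_
  change (mfderiv (𝓡 (n + 1)) (𝓡 n) pr p :
      EuclideanSpace ℝ (Fin (n + 1)) →L[ℝ] EuclideanSpace ℝ (Fin n)) (v i) = 0
  rw [hi, hpr.mfderiv_proj_eulerField]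

omit [MulAction ℝˣ P] [IsManifold (𝓡 (n + 1)) ∞ P] in
/-- The pulled back orientation form does not vanish on vectors that project to a basis. -/
theorem formPullback_proj_ne_zero (p : P) {w : Fin n → EuclideanSpace ℝ (Fin (n + 1))}
    (hw : LinearIndependent ℝ fun i : Fin n => (mfderiv (𝓡 (n + 1)) (𝓡 n) pr p :
        EuclideanSpace ℝ (Fin (n + 1)) →L[ℝ] EuclideanSpace ℝ (Fin n)) (w i)) :
    formPullback pr o.form p w ≠ 0 := by
  have key : ∀ α : EuclideanSpace ℝ (Fin n) [⋀^Fin n]→L[ℝ] ℝ, α ≠ 0 →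
      ∀ w : Fin n → EuclideanSpace ℝ (Fin n), LinearIndependent ℝ w → α w ≠ 0 :=
    fun α hα w hw => ContinuousAlternatingMap.apply_ne_zero_of_linearIndependent (by simp) hα hw
  exact key (o.form (pr p)) (o.ne_zero (pr p)) _ hw

theorem gInner_formPullback_proj_pos (hpr : IsPrincipalRxBundle n pr) (p : P) :
    0 < gInner g Θ p (formPullback pr o.form p) (formPullback pr o.form p) := by
  obtain ⟨e, he0, he, hli⟩ := exists_adapted_basis_at g Θ hpr p
  refine lt_of_lt_of_eq (formInner_self_pos _ _ he (formPullback pr o.form p) (fun v hv => ?_)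
    (formPullback_proj_ne_zero o p hli)) (gInner_eq g Θ p _ _).symm
  rw [he0] at hv
  exact formPullback_proj_eq_zero o hpr p v hv

theorem volTotal_ne_zero (hpr : IsPrincipalRxBundle n pr) (p : P) : volTotal g Θ o p ≠ 0 := by
  obtain ⟨e, he0, he, hli⟩ := exists_adapted_basis_at g Θ hpr p
  have hc := (inv_pos.2 (Real.sqrt_pos.2 (gInner_formPullback_proj_pos g Θ o hpr p))).ne'
  refine smul_ne_zero (pow_ne_zero _ (by norm_num))
    (wedge_one_form_ne_zero (V := EuclideanSpace ℝ (Fin (n + 1))) (e := e) _ _ ?_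
      (fun v hv => ?_) ?_)
  · rw [he0]
    exact (Θ.euler p).trans_ne one_ne_zero
  · rw [he0] at hv
    exact mul_eq_zero_of_right _ (formPullback_proj_eq_zero o hpr p v hv)
  · exact mul_ne_zero hc (formPullback_proj_ne_zero o p hli)

/-- `hodgeStar` is the unique solution of the equation that defines it. -/
theorem isHodgeDualAt_iff_eq_hodgeStar (hpr : IsPrincipalRxBundle n pr) {k m : ℕ}
    (h : k + m = n + 1) (ξ : DForm (n + 1) P k) (p : P)
    (β : TangentSpace (𝓡 (n + 1)) p [⋀^Fin m]→L[ℝ] ℝ) :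
    IsHodgeDualAt g Θ o p h (ξ p) β ↔ β = hodgeStar g Θ o h ξ p := by
  obtain ⟨e, f, hef⟩ := exists_dual_frame_at g Θ hpr p
  have huniq : ∀ β, IsHodgeDualAt g Θ o p h (ξ p) β ↔
      β = hodgeDualForm h e f (volTotal g Θ o p) (ξ p) :=
    fun β => (isHodgeDualAt_iff g Θ o p h _ β).trans
      (isHodgeDualForm_iff h (by simp) _ _ hef (volTotal_ne_zero g Θ o hpr p) _ _)
  have hstar : IsHodgeDualAt g Θ o p h (ξ p) (hodgeStar g Θ o h ξ p) :=
    Classical.epsilon_spec ⟨_, (huniq _).2 rfl⟩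
  rw [huniq, (huniq _).1 hstar]

theorem hodgeStar_eq_hodgeDualForm (hpr : IsPrincipalRxBundle n pr) (p : P)
    {e f : Fin (n + 1) → EuclideanSpace ℝ (Fin (n + 1))}
    (hef : ∀ i j, lorentzBilin g Θ p (f i) (e j) = if i = j then 1 else 0) {k m : ℕ}
    (h : k + m = n + 1) (ξ : DForm (n + 1) P k) :
    hodgeStar g Θ o h ξ p = hodgeDualForm h e f (volTotal g Θ o p) (ξ p) := by
  have h1 := (isHodgeDualAt_iff_eq_hodgeStar g Θ o hpr h ξ p _).2 rfl
  exact (isHodgeDualForm_iff h (by simp) _ _ hef (volTotal_ne_zero g Θ o hpr p) _ _).1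
    ((isHodgeDualAt_iff g Θ o p h _ _).1 h1)

end CarrollPointwise

/-! ### Invariance of the Hodge star under the Euler flow -/

section Invariance

variable {n : ℕ}
  {M : Type*} [TopologicalSpace M] [ChartedSpace (EuclideanSpace ℝ (Fin n)) M]
  {P : Type*} [TopologicalSpace P] [ChartedSpace (EuclideanSpace ℝ (Fin (n + 1))) P]
  [MulAction ℝˣ P] {pr : P → M}

/-- The derivative of the Euler flow, as an endomorphism of the model space. -/
noncomputable def eulerFlowDeriv (n : ℕ) {P : Type*} [TopologicalSpace P]
    [ChartedSpace (EuclideanSpace ℝ (Fin (n + 1))) P] [MulAction ℝˣ P] (s : ℝ) (p : P) :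
    EuclideanSpace ℝ (Fin (n + 1)) →L[ℝ] EuclideanSpace ℝ (Fin (n + 1)) :=
  mfderiv (𝓡 (n + 1)) (𝓡 (n + 1)) (eulerFlow s) p

theorem eulerFlowDeriv_zero (p : P) :
    eulerFlowDeriv n 0 p = ContinuousLinearMap.id ℝ (EuclideanSpace ℝ (Fin (n + 1))) := by
  have h : eulerFlow (P := P) 0 = fun p => p := funext eulerFlow_zero
  have h1 : eulerFlowDeriv n 0 p = (mfderiv (𝓡 (n + 1)) (𝓡 (n + 1)) (fun p : P => p) p :
      EuclideanSpace ℝ (Fin (n + 1)) →L[ℝ] EuclideanSpace ℝ (Fin (n + 1))) := by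
    unfold eulerFlowDeriv
    rw [h]
  exact h1.trans mfderiv_id

theorem eulerFlowDeriv_add (hpr : IsPrincipalRxBundle n pr) (t s : ℝ) (p : P) :
    eulerFlowDeriv n (t + s) p =
      (eulerFlowDeriv n t (eulerFlow s p)).comp (eulerFlowDeriv n s p) := by
  have h : eulerFlow (P := P) (t + s) = eulerFlow t ∘ eulerFlow s :=
    funext (eulerFlow_add t s)
  have h1 : eulerFlowDeriv n (t + s) p =
      (mfderiv (𝓡 (n + 1)) (𝓡 (n + 1)) (eulerFlow t ∘ eulerFlow s) p :
      EuclideanSpace ℝ (Fin (n + 1)) →L[ℝ] EuclideanSpace ℝ (Fin (n + 1))) := by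
    unfold eulerFlowDeriv
    rw [h]
  exact h1.trans (mfderiv_comp p (hpr.mdifferentiable_eulerFlow t _)
    (hpr.mdifferentiable_eulerFlow s _))

omit [TopologicalSpace P] in
theorem eulerFlow_neg_eulerFlow (s : ℝ) (p : P) : eulerFlow (-s) (eulerFlow s p) = p := by
  rw [← eulerFlow_add, neg_add_cancel, eulerFlow_zero]

/-- The derivative of the Euler flow is invertible. -/
noncomputable def eulerFlowDerivEquiv (hpr : IsPrincipalRxBundle n pr) (s : ℝ) (p : P) :
    EuclideanSpace ℝ (Fin (n + 1)) ≃L[ℝ] EuclideanSpace ℝ (Fin (n + 1)) :=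
  ContinuousLinearEquiv.equivOfInverse (eulerFlowDeriv n s p)
    (eulerFlowDeriv n (-s) (eulerFlow s p))
    (fun u => by
      have h := eulerFlowDeriv_add hpr (-s) s p
      rw [neg_add_cancel, eulerFlowDeriv_zero] at h
      exact (DFunLike.congr_fun h u).symm)
    (fun u => by
      have h := eulerFlowDeriv_add hpr s (-s) (eulerFlow s p)
      rw [add_neg_cancel, eulerFlowDeriv_zero, eulerFlow_neg_eulerFlow] at h
      exact (DFunLike.congr_fun h u).symm)

variable [IsManifold (𝓡 (n + 1)) ∞ P] (g : CarrollianMetric n pr) (Θ : RxConnection n P)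

/-- The flow of a Killing vector field preserves the metric: by the group property the derivative
of the pulled back metric vanishes at all times. -/
theorem CarrollianMetric.EulerIsKilling.toCLM_eulerFlow {g : CarrollianMetric n pr}
    (hg : g.EulerIsKilling) (hpr : IsPrincipalRxBundle n pr) (s : ℝ) (p : P)
    (u v : EuclideanSpace ℝ (Fin (n + 1))) :
    g.toCLM (eulerFlow s p) (eulerFlowDeriv n s p u) (eulerFlowDeriv n s p v) =
      g.toCLM p u v := by
  let F : ℝ → ℝ := fun s =>
    g.toCLM (eulerFlow s p) (eulerFlowDeriv n s p u) (eulerFlowDeriv n s p v)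
  have hF : ∀ s, HasDerivAt F 0 s := fun s => by
    have h1 : HasDerivAt (fun t => g.toCLM (eulerFlow t (eulerFlow s p))
        (eulerFlowDeriv n t (eulerFlow s p) (eulerFlowDeriv n s p u))
        (eulerFlowDeriv n t (eulerFlow s p) (eulerFlowDeriv n s p v))) 0 (s - s) := by
      rw [sub_self]
      exact hg (eulerFlow s p) (eulerFlowDeriv n s p u) (eulerFlowDeriv n s p v)
    have h2 : (fun t => g.toCLM (eulerFlow t (eulerFlow s p))
        (eulerFlowDeriv n t (eulerFlow s p) (eulerFlowDeriv n s p u))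
        (eulerFlowDeriv n t (eulerFlow s p) (eulerFlowDeriv n s p v))) = fun t => F (t + s) := by
      funext t
      simp only [F, eulerFlow_add, eulerFlowDeriv_add hpr, ContinuousLinearMap.comp_apply]
    rw [h2] at h1
    simpa using h1.comp_sub_const s s
  have h3 : F s = F 0 :=
    is_const_of_deriv_eq_zero (fun t => (hF t).differentiableAt) (fun t => (hF t).deriv) s 0
  simpa [F, eulerFlow_zero, eulerFlowDeriv_zero] using h3

theorem RxConnection.functional_eulerFlow (s : ℝ) (p : P) (u : EuclideanSpace ℝ (Fin (n + 1))) :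
    Θ.functional (eulerFlow s p) (eulerFlowDeriv n s p u) = Θ.functional p u :=
  congrArg (fun α : EuclideanSpace ℝ (Fin (n + 1)) [⋀^Fin 1]→L[ℝ] ℝ => α fun _ => u)
    (congrFun (Θ.invariant (Units.mk0 (Real.exp s) (Real.exp_ne_zero s))) p)

theorem lorentzBilin_eulerFlow {g : CarrollianMetric n pr} (hg : g.EulerIsKilling)
    (hpr : IsPrincipalRxBundle n pr) (s : ℝ) (p : P) (u v : EuclideanSpace ℝ (Fin (n + 1))) :
    lorentzBilin g Θ p u v = lorentzBilin g Θ (eulerFlow s p) (eulerFlowDerivEquiv hpr s p u)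
      (eulerFlowDerivEquiv hpr s p v) := by
  change _ = lorentzBilin g Θ (eulerFlow s p) (eulerFlowDeriv n s p u) (eulerFlowDeriv n s p v)
  rw [lorentzBilin_eq_toCLM, lorentzBilin_eq_toCLM, hg.toCLM_eulerFlow hpr,
    Θ.functional_eulerFlow, Θ.functional_eulerFlow]

theorem gInner_eulerFlow {g : CarrollianMetric n pr} (hg : g.EulerIsKilling)
    (hpr : IsPrincipalRxBundle n pr) {k : ℕ} (η ξ : DForm (n + 1) P k) (s : ℝ) (p : P) :
    gInner g Θ p (formPullback (eulerFlow s) η p) (formPullback (eulerFlow s) ξ p) =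
      gInner g Θ (eulerFlow s p) (η (eulerFlow s p)) (ξ (eulerFlow s p)) := by
  obtain ⟨e, f, hef⟩ := exists_dual_frame_at g Θ hpr (eulerFlow s p)
  exact (gInner_eq g Θ p _ _).trans
    ((formInner_compContinuousLinearMap (eulerFlowDerivEquiv hpr s p) _ _ _ _
      (lorentzBilin_eulerFlow Θ hg hpr s p) hef _ _).trans (gInner_eq g Θ _ _ _).symm)

variable [IsManifold (𝓡 n) ∞ M] (o : OrientationForm n M)

omit [IsManifold (𝓡 (n + 1)) ∞ P] in
theorem formPullback_eulerFlow_proj (hpr : IsPrincipalRxBundle n pr) (s : ℝ) :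
    formPullback (N := n + 1) (eulerFlow (P := P) s) (formPullback (N := n + 1) pr o.form) =
      formPullback pr o.form := by
  rw [← formPullback_comp o.form (hpr.smooth_proj.mdifferentiable (by simp))
    (hpr.mdifferentiable_eulerFlow s)]
  congr 1
  exact funext fun p => hpr.proj_smul _ p

theorem formPullback_eulerFlow_volBase {g : CarrollianMetric n pr} (hg : g.EulerIsKilling)
    (hpr : IsPrincipalRxBundle n pr) (s : ℝ) :
    formPullback (eulerFlow s) (volBase g Θ o) = volBase g Θ o := by
  funext p
  have h1 := gInner_eulerFlow Θ hg hpr (formPullback pr o.form) (formPullback pr o.form) s p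
  rw [formPullback_eulerFlow_proj o hpr] at h1
  unfold volBase
  rw [h1]
  exact congrArg ((√(gInner g Θ (eulerFlow s p) (formPullback pr o.form (eulerFlow s p))
    (formPullback pr o.form (eulerFlow s p))))⁻¹ • ·)
    (congrFun (formPullback_eulerFlow_proj o hpr s) p)

theorem formPullback_eulerFlow_volTotal {g : CarrollianMetric n pr} (hg : g.EulerIsKilling)
    (hpr : IsPrincipalRxBundle n pr) (s : ℝ) :
    formPullback (eulerFlow s) (volTotal g Θ o) = volTotal g Θ o := by
  funext p
  refine congrArg ((-1 : ℝ) ^ n • ·) ((wedge_compContinuousLinearMap (Nat.add_comm 1 n)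
    (V := EuclideanSpace ℝ (Fin (n + 1))) _ _ (eulerFlowDeriv n s p)).symm.trans ?_)
  have h1 : (Θ.form (eulerFlow s p) :
      EuclideanSpace ℝ (Fin (n + 1)) [⋀^Fin 1]→L[ℝ] ℝ).compContinuousLinearMap
        (eulerFlowDeriv n s p) = Θ.form p := congrFun (Θ.invariant _) p
  have h2 : (volBase g Θ o (eulerFlow s p) :
      EuclideanSpace ℝ (Fin (n + 1)) [⋀^Fin n]→L[ℝ] ℝ).compContinuousLinearMap
        (eulerFlowDeriv n s p) = volBase g Θ o p :=
    congrFun (formPullback_eulerFlow_volBase Θ o hg hpr s) p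
  exact congrArg₂ (wedge (V := EuclideanSpace ℝ (Fin (n + 1))) (Nat.add_comm 1 n)) h1 h2

/-- The Hodge star commutes with pullback along the Euler flow, because `G` and `Vol_P` are
invariant. -/
theorem formPullback_eulerFlow_hodgeStar {g : CarrollianMetric n pr} (hg : g.EulerIsKilling)
    (hpr : IsPrincipalRxBundle n pr) {k m : ℕ} (h : k + m = n + 1) (ξ : DForm (n + 1) P k)
    (s : ℝ) : formPullback (eulerFlow s) (hodgeStar g Θ o h ξ) =
      hodgeStar g Θ o h (formPullback (eulerFlow s) ξ) := by
  funext p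
  obtain ⟨e, f, hef⟩ := exists_dual_frame_at g Θ hpr (eulerFlow s p)
  refine (isHodgeDualAt_iff_eq_hodgeStar g Θ o hpr h _ p _).1
    ((isHodgeDualAt_iff g Θ o p h _ _).2 ?_)
  rw [← formPullback_eulerFlow_volTotal Θ o hg hpr s]
  exact IsHodgeDualForm.compContinuousLinearMap (eulerFlowDerivEquiv hpr s p)
    (lorentzBilin_eulerFlow Θ hg hpr s p) hef ((isHodgeDualAt_iff g Θ o _ h _ _).1
      ((isHodgeDualAt_iff_eq_hodgeStar g Θ o hpr h ξ (eulerFlow s p) _).2 rfl))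

/-- The Hodge star commutes with the Lie derivative: at each point it is a fixed linear map, and it
commutes with pullback along the flow. -/
theorem lieEuler_hodgeStar {g : CarrollianMetric n pr} (hg : g.EulerIsKilling)
    (hpr : IsPrincipalRxBundle n pr) {k m : ℕ} (h : k + m = n + 1) {ξ : DForm (n + 1) P k}
    (hξ : IsSmoothForm ξ) : lieEuler (hodgeStar g Θ o h ξ) = hodgeStar g Θ o h (lieEuler ξ) := by
  funext p
  obtain ⟨e, f, hef⟩ := exists_dual_frame_at g Θ hpr p
  have h1 : (fun s : ℝ => (formPullback (eulerFlow s) (hodgeStar g Θ o h ξ) p :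
      EuclideanSpace ℝ (Fin (n + 1)) [⋀^Fin m]→L[ℝ] ℝ)) = fun s =>
      hodgeDualForm (V := EuclideanSpace ℝ (Fin (n + 1))) h e f (volTotal g Θ o p)
        (formPullback (eulerFlow s) ξ p) := by
    funext s
    exact (congrFun (formPullback_eulerFlow_hodgeStar Θ o hg hpr h ξ s) p).trans
      (hodgeStar_eq_hodgeDualForm g Θ o hpr p hef h _)
  refine (congrArg (fun F : ℝ → EuclideanSpace ℝ (Fin (n + 1)) [⋀^Fin m]→L[ℝ] ℝ => deriv F 0)
    h1).trans ?_
  exact (hasDerivAt_hodgeDualForm (E := EuclideanSpace ℝ (Fin (n + 1))) h e f _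
    (hξ.hasDerivAt_lieEuler hpr p)).deriv.trans
    (hodgeStar_eq_hodgeDualForm g Θ o hpr p hef h _).symm

theorem hodgeStar_smul (hpr : IsPrincipalRxBundle n pr) {k m : ℕ} (h : k + m = n + 1) (c : ℝ)
    (ξ : DForm (n + 1) P k) : hodgeStar g Θ o h (c • ξ) = c • hodgeStar g Θ o h ξ := by
  funext p
  obtain ⟨e, f, hef⟩ := exists_dual_frame_at g Θ hpr p
  refine (hodgeStar_eq_hodgeDualForm g Θ o hpr p hef h _).trans (Eq.trans ?_
    (congrArg (c • ·) (hodgeStar_eq_hodgeDualForm g Θ o hpr p hef h ξ).symm))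
  exact hodgeDualForm_smul (V := EuclideanSpace ℝ (Fin (n + 1))) h e f _ c _

end Invariance

/-! ### Smoothness of the Hodge star -/

section MatrixSmoothness

variable {S : Type*} [NormedAddCommGroup S] [NormedSpace ℝ S] {ι : Type*} [Fintype ι]
  [DecidableEq ι] {r : ℕ∞ω} {x : S}

theorem ContDiffAt.matrix_det {A : S → Matrix ι ι ℝ}
    (hA : ∀ i j, ContDiffAt ℝ r (fun y => A y i j) x) : ContDiffAt ℝ r (fun y => (A y).det) x := by
  simp only [Matrix.det_apply']
  exact ContDiffAt.sum fun σ _ => contDiffAt_const.mul (contDiffAt_prod fun i _ => hA _ _)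

theorem ContDiffAt.matrix_inv {A : S → Matrix ι ι ℝ}
    (hA : ∀ i j, ContDiffAt ℝ r (fun y => A y i j) x) (h : (A x).det ≠ 0) (i j : ι) :
    ContDiffAt ℝ r (fun y => (A y)⁻¹ i j) x := by
  simp only [Matrix.inv_def, Ring.inverse_eq_inv', Matrix.smul_apply, smul_eq_mul,
    Matrix.adjugate_apply]
  refine ((ContDiffAt.matrix_det hA).inv h).mul (ContDiffAt.matrix_det fun a b => ?_)
  simp only [Matrix.updateRow_apply]
  split_ifs
  · exact contDiffAt_const
  · exact hA _ _

end MatrixSmoothness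

section ChartDerivative

variable {N : ℕ} {X : Type*} [TopologicalSpace X] [ChartedSpace (EuclideanSpace ℝ (Fin N)) X]

/-- The derivative of the inverse of the preferred chart at `x₀`, as an endomorphism of the model
space. -/
noncomputable def chartSymmDeriv (x₀ : X) (u : EuclideanSpace ℝ (Fin N)) :
    EuclideanSpace ℝ (Fin N) →L[ℝ] EuclideanSpace ℝ (Fin N) :=
  mfderiv 𝓘(ℝ, EuclideanSpace ℝ (Fin N)) (𝓡 N) (extChartAt (𝓡 N) x₀).symm u

theorem exists_equiv_chartSymmDeriv [IsManifold (𝓡 N) ∞ X] {x₀ : X} {u : EuclideanSpace ℝ (Fin N)}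
    (hu : u ∈ (extChartAt (𝓡 N) x₀).target) :
    ∃ A : EuclideanSpace ℝ (Fin N) ≃L[ℝ] EuclideanSpace ℝ (Fin N),
      (A : EuclideanSpace ℝ (Fin N) →L[ℝ] EuclideanSpace ℝ (Fin N)) = chartSymmDeriv x₀ u := by
  obtain ⟨x, hx, rfl⟩ : ∃ x ∈ (chartAt (EuclideanSpace ℝ (Fin N)) x₀).source,
      extChartAt (𝓡 N) x₀ x = u :=
    ⟨_, by simpa using (extChartAt (𝓡 N) x₀).map_target hu, (extChartAt (𝓡 N) x₀).right_inv hu⟩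
  exact ⟨ContinuousLinearEquiv.equivOfInverse (chartSymmDeriv x₀ (extChartAt (𝓡 N) x₀ x))
    (mfderiv (𝓡 N) 𝓘(ℝ, EuclideanSpace ℝ (Fin N)) (extChartAt (𝓡 N) x₀) x :
      EuclideanSpace ℝ (Fin N) →L[ℝ] EuclideanSpace ℝ (Fin N))
    (mfderiv_extChartAt_comp_mfderiv_symm x₀ hx) (mfderiv_symm_comp_mfderiv_extChartAt x₀ hx), rfl⟩

end ChartDerivative

section StarSmooth

variable {n : ℕ}
  {M : Type*} [TopologicalSpace M] [ChartedSpace (EuclideanSpace ℝ (Fin n)) M]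
  {P : Type*} [TopologicalSpace P] [ChartedSpace (EuclideanSpace ℝ (Fin (n + 1))) P]
  [MulAction ℝˣ P] {pr : P → M} [IsManifold (𝓡 (n + 1)) ∞ P] (g : CarrollianMetric n pr)
  (Θ : RxConnection n P)

omit [MulAction ℝˣ P] in
/-- The components of the Carrollian metric in a chart are smooth. -/
theorem CarrollianMetric.contDiffAt_inChart (x : P) (a b : EuclideanSpace ℝ (Fin (n + 1))) :
    ContDiffAt ℝ ∞ (fun u => g.toCLM ((extChartAt (𝓡 (n + 1)) x).symm u) (chartSymmDeriv x u a)
      (chartSymmDeriv x u b)) (extChartAt (𝓡 (n + 1)) x x) := by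
  have := isManifold_one (N := n + 1) (X := P)
  have h0 := g.smooth x
  rw [contMDiffAt_section, contMDiffAt_iff_source, ModelWithCorners.range_eq_univ,
    contMDiffWithinAt_univ, contMDiffAt_iff_contDiffAt] at h0
  refine ((h0.clm_apply (contDiffAt_const (c := a))).clm_apply
    (contDiffAt_const (c := b))).congr_of_eventuallyEq ?_
  filter_upwards [extChartAt_target_mem_nhds (I := 𝓡 (n + 1)) x] with y hy
  have hy' : (extChartAt (𝓡 (n + 1)) x).symm y ∈
      (chartAt (EuclideanSpace ℝ (Fin (n + 1))) x).source := by
    simpa using (extChartAt (𝓡 (n + 1)) x).map_target hy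
  have h1 := TangentBundle.symmL_trivializationAt (I := 𝓡 (n + 1)) hy'
  rw [(extChartAt (𝓡 (n + 1)) x).right_inv hy, ModelWithCorners.range_eq_univ,
    mfderivWithin_univ] at h1
  have h2 : ∀ v, (trivializationAt (EuclideanSpace ℝ (Fin (n + 1)))
      (TangentSpace (𝓡 (n + 1)) : P → Type _) x).symm ((extChartAt (𝓡 (n + 1)) x).symm y) v =
      chartSymmDeriv x y v := fun v =>
      (Trivialization.symmL_apply (R := ℝ) _ (by simpa using hy') v).symm.trans
        (congrArg (fun A : EuclideanSpace ℝ (Fin (n + 1)) →L[ℝ] EuclideanSpace ℝ (Fin (n + 1)) =>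
          A v) h1)
  simp only [Function.comp_apply, hom_trivializationAt_apply]
  refine ((inCoordinates_apply_eq₂ (F₃ := ℝ) (E₃ := Bundle.Trivial P ℝ)
    (by simpa using hy') (by simpa using hy') (Set.mem_univ _)).trans ?_).symm
  rw [h2, h2]
  simp
  rfl

/-- The Lorentzian metric in a chart. -/
noncomputable def lorentzInChart (x : P) (u : EuclideanSpace ℝ (Fin (n + 1))) :
    LinearMap.BilinForm ℝ (EuclideanSpace ℝ (Fin (n + 1))) :=
  (lorentzBilin g Θ ((extChartAt (𝓡 (n + 1)) x).symm u)).compl₁₂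
    (chartSymmDeriv x u : EuclideanSpace ℝ (Fin (n + 1)) →ₗ[ℝ] EuclideanSpace ℝ (Fin (n + 1)))
    (chartSymmDeriv x u : EuclideanSpace ℝ (Fin (n + 1)) →ₗ[ℝ] EuclideanSpace ℝ (Fin (n + 1)))

theorem contDiffAt_lorentzInChart (x : P) (a b : EuclideanSpace ℝ (Fin (n + 1))) :
    ContDiffAt ℝ ∞ (fun u => lorentzInChart g Θ x u a b) (extChartAt (𝓡 (n + 1)) x x) := by
  have h := fun c => contDiffAt_form_iff.1 (isSmoothForm_iff.1 Θ.smooth x) fun _ => c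
  exact (g.contDiffAt_inChart x a b).sub ((h a).mul (h b))

/-- The Gram matrix of the Lorentzian metric in a chart. -/
noncomputable def lorentzGram (x : P) (u : EuclideanSpace ℝ (Fin (n + 1))) :
    Matrix (Fin (n + 1)) (Fin (n + 1)) ℝ :=
  Matrix.of fun a c => lorentzInChart g Θ x u
    ((EuclideanSpace.basisFun (Fin (n + 1)) ℝ).toBasis a)
    ((EuclideanSpace.basisFun (Fin (n + 1)) ℝ).toBasis c)

theorem isUnit_det_lorentzGram (hpr : IsPrincipalRxBundle n pr) {x : P}
    {u : EuclideanSpace ℝ (Fin (n + 1))} (hu : u ∈ (extChartAt (𝓡 (n + 1)) x).target) :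
    IsUnit (lorentzGram g Θ x u).det := by
  obtain ⟨e, f, hef⟩ := exists_dual_frame_at g Θ hpr ((extChartAt (𝓡 (n + 1)) x).symm u)
  obtain ⟨A, hA⟩ := exists_equiv_chartSymmDeriv hu
  have hA' : ∀ v, chartSymmDeriv x u (A.symm v) = v := fun v => by
    rw [← hA]; exact A.apply_symm_apply v
  refine isUnit_det_gram_of_dual_frame _ (lorentzInChart g Θ x u)
    (e := fun i => A.symm (e i)) (f := fun i => A.symm (f i)) fun i j => ?_
  rw [← hef i j]
  change lorentzBilin g Θ _ (chartSymmDeriv x u (A.symm (f i)))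
    (chartSymmDeriv x u (A.symm (e j))) = _
  rw [hA', hA']

theorem contDiffAt_lorentzGram_inv (hpr : IsPrincipalRxBundle n pr) (x : P) (i j : Fin (n + 1)) :
    ContDiffAt ℝ ∞ (fun u => (lorentzGram g Θ x u)⁻¹ i j) (extChartAt (𝓡 (n + 1)) x x) :=
  ContDiffAt.matrix_inv (fun _ _ => contDiffAt_lorentzInChart g Θ x _ _)
    (isUnit_det_lorentzGram g Θ hpr (mem_extChartAt_target x)).ne_zero i j

theorem gInner_eq_formInner_inChart (hpr : IsPrincipalRxBundle n pr) {x : P}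
    {u : EuclideanSpace ℝ (Fin (n + 1))} (hu : u ∈ (extChartAt (𝓡 (n + 1)) x).target) {k : ℕ}
    (η ξ : DForm (n + 1) P k) :
    gInner g Θ ((extChartAt (𝓡 (n + 1)) x).symm u) (η ((extChartAt (𝓡 (n + 1)) x).symm u))
      (ξ ((extChartAt (𝓡 (n + 1)) x).symm u)) =
      formInner (EuclideanSpace.basisFun (Fin (n + 1)) ℝ).toBasis
        (fun v w => lorentzInChart g Θ x u v w) (formInChart η x u) (formInChart ξ x u) := by
  obtain ⟨e, f, hef⟩ := exists_dual_frame_at g Θ hpr ((extChartAt (𝓡 (n + 1)) x).symm u)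
  obtain ⟨A, hA⟩ := exists_equiv_chartSymmDeriv hu
  have hB : ∀ v w, lorentzInChart g Θ x u v w =
      lorentzBilin g Θ ((extChartAt (𝓡 (n + 1)) x).symm u) (A v) (A w) := fun v w => by
    change lorentzBilin g Θ _ (chartSymmDeriv x u v) (chartSymmDeriv x u w) = _
    rw [← hA]; rfl
  have h := formInner_compContinuousLinearMap A (EuclideanSpace.basisFun (Fin (n + 1)) ℝ).toBasis
    (tangentBasis (n + 1) ((extChartAt (𝓡 (n + 1)) x).symm u)) _ _ hB hef
    (η ((extChartAt (𝓡 (n + 1)) x).symm u)) (ξ ((extChartAt (𝓡 (n + 1)) x).symm u))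
  rw [hA] at h
  exact (gInner_eq g Θ _ _ _).trans h.symm

theorem contDiffAt_gInner_inChart (hpr : IsPrincipalRxBundle n pr) (x : P) {k : ℕ}
    {η ξ : DForm (n + 1) P k} (hη : IsSmoothForm η) (hξ : IsSmoothForm ξ) :
    ContDiffAt ℝ ∞ (fun u => gInner g Θ ((extChartAt (𝓡 (n + 1)) x).symm u)
      (η ((extChartAt (𝓡 (n + 1)) x).symm u)) (ξ ((extChartAt (𝓡 (n + 1)) x).symm u)))
      (extChartAt (𝓡 (n + 1)) x x) := by
  refine ContDiffAt.congr_of_eventuallyEq ?_ (Filter.eventually_of_mem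
    (extChartAt_target_mem_nhds (I := 𝓡 (n + 1)) x)
    fun u hu => gInner_eq_formInner_inChart g Θ hpr hu η ξ)
  refine contDiffAt_const.mul (ContDiffAt.sum fun i _ => ContDiffAt.sum fun j _ =>
    ((contDiffAt_prod fun s _ => contDiffAt_lorentzGram_inv g Θ hpr x _ _).mul
      (contDiffAt_form_iff.1 (isSmoothForm_iff.1 hη x) _)).mul
      (contDiffAt_form_iff.1 (isSmoothForm_iff.1 hξ x) _))

variable [IsManifold (𝓡 n) ∞ M] (o : OrientationForm n M)

theorem isSmoothForm_volBase (hpr : IsPrincipalRxBundle n pr) : IsSmoothForm (volBase g Θ o) := by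
  have hτ : IsSmoothForm (formPullback (N := n + 1) pr o.form) :=
    IsSmoothForm.pullback o.smooth hpr.smooth_proj
  refine isSmoothForm_iff.2 fun x => ?_
  have hpos := gInner_formPullback_proj_pos g Θ o hpr
    ((extChartAt (𝓡 (n + 1)) x).symm (extChartAt (𝓡 (n + 1)) x x))
  exact ContDiffAt.smul (F := EuclideanSpace ℝ (Fin (n + 1)) [⋀^Fin n]→L[ℝ] ℝ)
    (((contDiffAt_gInner_inChart g Θ hpr x hτ hτ).sqrt hpos.ne').inv
      (Real.sqrt_pos.2 hpos).ne') (isSmoothForm_iff.1 hτ x)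

theorem isSmoothForm_volTotal (hpr : IsPrincipalRxBundle n pr) :
    IsSmoothForm (volTotal g Θ o) := by
  refine isSmoothForm_iff.2 fun x => ?_
  have h := ContDiffAt.wedge (Nat.add_comm 1 n) (isSmoothForm_iff.1 Θ.smooth x)
    (isSmoothForm_iff.1 (isSmoothForm_volBase g Θ o hpr) x)
  have h2 : formInChart (volTotal g Θ o) x = fun u => ((-1 : ℝ) ^ n) •
      wedge (Nat.add_comm 1 n) (formInChart Θ.form x u) (formInChart (volBase g Θ o) x u) :=
    funext fun u => congrArg ((-1 : ℝ) ^ n • ·) (wedge_compContinuousLinearMap (Nat.add_comm 1 n)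
      (V := EuclideanSpace ℝ (Fin (n + 1))) _ _ (chartSymmDeriv x u)).symm
  rw [h2]
  exact ContDiffAt.const_smul (F := EuclideanSpace ℝ (Fin (n + 1)) [⋀^Fin (n + 1)]→L[ℝ] ℝ) _ h

/-- The frame dual to the coordinate frame with respect to the Lorentzian metric in a chart. -/
noncomputable def lorentzDualFrame (x : P) (u : EuclideanSpace ℝ (Fin (n + 1)))
    (i : Fin (n + 1)) : EuclideanSpace ℝ (Fin (n + 1)) :=
  ∑ c, (lorentzGram g Θ x u)⁻¹ i c • (EuclideanSpace.basisFun (Fin (n + 1)) ℝ).toBasis c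

/-- The Hodge star in a chart, in the coordinate frame and the frame dual to it. -/
theorem formInChart_hodgeStar (hpr : IsPrincipalRxBundle n pr) {x : P}
    {u : EuclideanSpace ℝ (Fin (n + 1))} (hu : u ∈ (extChartAt (𝓡 (n + 1)) x).target) {k m : ℕ}
    (h : k + m = n + 1) (ξ : DForm (n + 1) P k) :
    formInChart (hodgeStar g Θ o h ξ) x u =
      hodgeDualForm h (EuclideanSpace.basisFun (Fin (n + 1)) ℝ).toBasis
        (lorentzDualFrame g Θ x u) (formInChart (volTotal g Θ o) x u) (formInChart ξ x u) := by
  obtain ⟨e, f, hef⟩ := exists_dual_frame_at g Θ hpr ((extChartAt (𝓡 (n + 1)) x).symm u)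
  obtain ⟨A, hA⟩ := exists_equiv_chartSymmDeriv hu
  have hB : ∀ v w, lorentzInChart g Θ x u v w =
      lorentzBilin g Θ ((extChartAt (𝓡 (n + 1)) x).symm u) (A v) (A w) := fun v w => by
    change lorentzBilin g Θ _ (chartSymmDeriv x u v) (chartSymmDeriv x u w) = _
    rw [← hA]; rfl
  have h1 := IsHodgeDualForm.compContinuousLinearMap A
    (b := (EuclideanSpace.basisFun (Fin (n + 1)) ℝ).toBasis) hB hef
    ((isHodgeDualAt_iff g Θ o _ h _ _).1
      ((isHodgeDualAt_iff_eq_hodgeStar g Θ o hpr h ξ _ _).2 rfl))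
  rw [hA] at h1
  refine (isHodgeDualForm_iff h (by simp) _ (lorentzInChart g Θ x u)
    (exists_dual_frame_of_isUnit_det _ _ (isUnit_det_lorentzGram g Θ hpr hu)) ?_ _ _).1 h1
  intro h0
  refine volTotal_ne_zero g Θ o hpr ((extChartAt (𝓡 (n + 1)) x).symm u) ?_
  ext v
  have hv : (fun i => chartSymmDeriv x u (A.symm (v i))) = v := funext fun i => by
    rw [← hA]; exact A.apply_symm_apply (v i)
  exact (congrArg (volTotal g Θ o ((extChartAt (𝓡 (n + 1)) x).symm u) :
    EuclideanSpace ℝ (Fin (n + 1)) [⋀^Fin (n + 1)]→L[ℝ] ℝ) hv).symm.trans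
    (DFunLike.congr_fun h0 fun i => A.symm (v i))

theorem IsSmoothForm.hodgeStar (hpr : IsPrincipalRxBundle n pr) {k m : ℕ} (h : k + m = n + 1)
    {ξ : DForm (n + 1) P k} (hξ : IsSmoothForm ξ) : IsSmoothForm (_root_.hodgeStar g Θ o h ξ) := by
  refine isSmoothForm_iff.2 fun x => ?_
  refine ContDiffAt.congr_of_eventuallyEq ?_ (Filter.eventually_of_mem
    (extChartAt_target_mem_nhds (I := 𝓡 (n + 1)) x)
    fun u hu => formInChart_hodgeStar g Θ o hpr hu h ξ)
  refine ContDiffAt.const_smul (F := EuclideanSpace ℝ (Fin (n + 1)) [⋀^Fin m]→L[ℝ] ℝ) _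
    (ContDiffAt.sum (F := EuclideanSpace ℝ (Fin (n + 1)) [⋀^Fin m]→L[ℝ] ℝ) fun i _ =>
      ContDiffAt.fun_smul (F := EuclideanSpace ℝ (Fin (n + 1)) [⋀^Fin m]→L[ℝ] ℝ) ?_
        (contDiffAt_form_iff.2 fun v => ?_))
  · exact (isSmoothForm_iff.1 hξ x).form_apply fun s => ContDiffAt.sum fun c _ =>
      (contDiffAt_lorentzGram_inv g Θ hpr x _ _).smul contDiffAt_const
  · exact contDiffAt_form_iff.1 (isSmoothForm_iff.1 (isSmoothForm_volTotal g Θ o hpr) x) _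

end StarSmooth

/-! ### The codifferential and the Hodge–de Rham Laplacian -/

section Laplacian

variable {n : ℕ}
  {M : Type*} [TopologicalSpace M] [ChartedSpace (EuclideanSpace ℝ (Fin n)) M]
  {P : Type*} [TopologicalSpace P] [ChartedSpace (EuclideanSpace ℝ (Fin (n + 1))) P]
  [MulAction ℝˣ P] {pr : P → M} [IsManifold (𝓡 n) ∞ M] [IsManifold (𝓡 (n + 1)) ∞ P]
  (g : CarrollianMetric n pr) (Θ : RxConnection n P) (o : OrientationForm n M)

omit [IsManifold (𝓡 n) ∞ M] in
theorem lieEuler_zero (hpr : IsPrincipalRxBundle n pr) {k : ℕ} :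
    lieEuler (0 : DForm (n + 1) P k) = 0 := by
  simpa using lieEuler_smul hpr 0 (isSmoothForm_zero (N := n + 1) (X := P) (k := k))

theorem codiff_smul (hpr : IsPrincipalRxBundle n pr) {k : ℕ} (c : ℝ)
    (ξ : DForm (n + 1) P (k + 1)) : codiff g Θ o (c • ξ) = c • codiff g Θ o ξ := by
  unfold codiff
  split_ifs with h
  · rw [hodgeStar_smul g Θ o hpr, formD_smul, hodgeStar_smul g Θ o hpr, smul_comm]
  · rw [smul_zero]

theorem IsSmoothForm.codifferential (hpr : IsPrincipalRxBundle n pr) {k : ℕ}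
    {ξ : DForm (n + 1) P (k + 1)} (hξ : IsSmoothForm ξ) : IsSmoothForm (codiff g Θ o ξ) := by
  unfold codiff
  split_ifs with h
  · exact ((hξ.hodgeStar g Θ o hpr _).differential.hodgeStar g Θ o hpr _).const_smul _
  · exact isSmoothForm_zero

variable {g} in
theorem lieEuler_codiff (hg : g.EulerIsKilling) (hpr : IsPrincipalRxBundle n pr) {k : ℕ}
    {ξ : DForm (n + 1) P (k + 1)} (hξ : IsSmoothForm ξ) :
    lieEuler (codiff g Θ o ξ) = codiff g Θ o (lieEuler ξ) := by
  unfold codiff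
  split_ifs with h
  · have h1 : k + 1 + (n + 1 - (k + 1)) = n + 1 := by omega
    have h2 : n + 1 - (k + 1) + 1 + k = n + 1 := by omega
    have hs := hξ.hodgeStar g Θ o hpr h1
    rw [lieEuler_smul hpr _ (hs.differential.hodgeStar g Θ o hpr h2),
      lieEuler_hodgeStar Θ o hg hpr h2 hs.differential, lieEuler_formD hpr hs,
      lieEuler_hodgeStar Θ o hg hpr h1 hξ]
  · exact lieEuler_zero hpr

theorem hodgeLaplacian_smul (hpr : IsPrincipalRxBundle n pr) {k : ℕ} (c : ℝ)
    (ξ : DForm (n + 1) P k) : hodgeLaplacian g Θ o (c • ξ) = c • hodgeLaplacian g Θ o ξ := by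
  cases k with
  | zero => simp only [hodgeLaplacian, formD_smul, codiff_smul g Θ o hpr]
  | succ k => simp only [hodgeLaplacian, formD_smul, codiff_smul g Θ o hpr, smul_add]

theorem IsSmoothForm.laplacian (hpr : IsPrincipalRxBundle n pr) {k : ℕ}
    {ξ : DForm (n + 1) P k} (hξ : IsSmoothForm ξ) : IsSmoothForm (hodgeLaplacian g Θ o ξ) := by
  cases k with
  | zero => exact hξ.differential.codifferential g Θ o hpr
  | succ k =>
    exact (hξ.codifferential g Θ o hpr).differential.add
      (hξ.differential.codifferential g Θ o hpr)

variable {g} in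
theorem lieEuler_hodgeLaplacian (hg : g.EulerIsKilling) (hpr : IsPrincipalRxBundle n pr) {k : ℕ}
    {ξ : DForm (n + 1) P k} (hξ : IsSmoothForm ξ) :
    lieEuler (hodgeLaplacian g Θ o ξ) = hodgeLaplacian g Θ o (lieEuler ξ) := by
  have h1 := lieEuler_codiff Θ o hg hpr hξ.differential
  rw [lieEuler_formD hpr hξ] at h1
  cases k with
  | zero => exact h1
  | succ k =>
    simp only [hodgeLaplacian]
    rw [lieEuler_add hpr (hξ.codifferential g Θ o hpr).differential
      (hξ.differential.codifferential g Θ o hpr), h1,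
      lieEuler_formD hpr (hξ.codifferential g Θ o hpr), lieEuler_codiff Θ o hg hpr hξ]

end Laplacian

theorem mainTheorem3 (n : ℕ)
    {M : Type*} [TopologicalSpace M] [T2Space M] [SecondCountableTopology M]
    [ChartedSpace (EuclideanSpace ℝ (Fin n)) M] [IsManifold (𝓡 n) ∞ M]
    {P : Type*} [TopologicalSpace P] [T2Space P] [SecondCountableTopology P]
    [ChartedSpace (EuclideanSpace ℝ (Fin (n + 1))) P] [IsManifold (𝓡 (n + 1)) ∞ P]
    [MulAction ℝˣ P] (pr : P → M) (hpr : IsPrincipalRxBundle n pr)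
    (g : CarrollianMetric n pr) (hg : g.EulerIsKilling)
    (Θ : RxConnection n P) (o : OrientationForm n M) :
    -- the Hodge star is well defined and maps smooth forms to smooth forms
    (∀ (k m : ℕ) (h : k + m = n + 1) (ξ : DForm (n + 1) P k), IsSmoothForm ξ →
      IsSmoothForm (hodgeStar g Θ o h ξ) ∧
      ∀ (p : P) (β : TangentSpace (𝓡 (n + 1)) p [⋀^Fin m]→L[ℝ] ℝ),
        IsHodgeDualAt g Θ o p h (ξ p) β ↔ β = hodgeStar g Θ o h ξ p) ∧
    -- the codifferential
    (∀ (k : ℕ) (ξ : DForm (n + 1) P (k + 1)), IsSmoothForm ξ →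
      IsSmoothForm (codiff g Θ o ξ) ∧
      lieEuler (codiff g Θ o ξ) = codiff g Θ o (lieEuler ξ) ∧
      ∀ w : ℝ, IsHomogeneousOfWeight w ξ → IsHomogeneousOfWeight w (codiff g Θ o ξ)) ∧
    -- the Hodge–de Rham Laplacian
    (∀ (k : ℕ) (ξ : DForm (n + 1) P k), IsSmoothForm ξ →
      IsSmoothForm (hodgeLaplacian g Θ o ξ) ∧
      lieEuler (hodgeLaplacian g Θ o ξ) = hodgeLaplacian g Θ o (lieEuler ξ) ∧
      ∀ w : ℝ, IsHomogeneousOfWeight w ξ → IsHomogeneousOfWeight w (hodgeLaplacian g Θ o ξ)) := by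
  refine ⟨fun k m h ξ hξ => ⟨hξ.hodgeStar g Θ o hpr h,
      fun p β => isHodgeDualAt_iff_eq_hodgeStar g Θ o hpr h ξ p β⟩,
    fun k ξ hξ => ⟨hξ.codifferential g Θ o hpr, lieEuler_codiff Θ o hg hpr hξ, fun w hw => ?_⟩,
    fun k ξ hξ => ⟨hξ.laplacian g Θ o hpr, lieEuler_hodgeLaplacian Θ o hg hpr hξ, fun w hw => ?_⟩⟩
  · exact (lieEuler_codiff Θ o hg hpr hξ).trans
      ((congrArg (codiff g Θ o) hw).trans (codiff_smul g Θ o hpr w ξ))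
  · exact (lieEuler_hodgeLaplacian Θ o hg hpr hξ).trans
      ((congrArg (hodgeLaplacian g Θ o) hw).trans (hodgeLaplacian_smul g Θ o hpr w ξ))
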